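/- Let $\mathcal L\subset\mathbb R^{2n}=\{(P,Q)\}$ be a $k$-dimensional subspace, isotropic for $\omega((P,Q),(P',Q'))=\sum_j(P_jQ'_j-P'_jQ_j)$, with a shift-invariant (Haar) measure $d\mu$, and suppose that $(P,Q)\mapsto Q$ is injective on $\mathcal L$ (i.e. $\mathcal L$ projects uniquely to the plane $P=0$). Let $\Omega(P,Q)=\sum_j\left(P_j\xi_j-Q_j\frac1i\frac{\partial}{\partial\xi_j}\right)$, so that for real $X=(P,Q)$ one has $(e^{i\Omega(X)}\psi)(\xi)=e^{i(P\cdot\xi-P\cdot Q/2)}\psi(\xi-Q)$. Let $\psi_A(\xi)=c\,e^{\frac i2\xi\cdot A\xi}$, where $c\ne0$ and $A$ is a complex symmetric matrix with positive definite imaginary part, and let $\psi_D=\int_{\mathcal L}d\mu(X)\,e^{i\Omega(X)}\psi_A$ be the corresponding Dirac wave function. Put $\langle\varphi,\psi\rangle=\int_{\mathcal L}d\mu(X)\,(\varphi,e^{i\Omega(X)}\psi)$ with $(\varphi,\psi)=\int\bar\varphi\psi\,d\xi$, and define (with $*$ the complex conjugation, $\perp\omega$ the skew-orthogonal complement in $\mathbb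 C^{2n}$) $$r=\{Y\in\mathbb C^{2n}:\Omega(Y)\psi_A=0\},\qquad \check r=\{Y\in(\mathcal L^{\mathbb C})^{\perp\omega}:\langle\Omega(Y)\psi_A,\Omega(Y)\psi_A\rangle=0\},$$ $$r_\perp=r\cap(\mathcal L^{\mathbb C})^{\perp\omega},\qquad r_-=\{Y\in r:\omega(Y,Y'^*)=0\ \text{for all } Y'\in r_\perp\}.$$ Then the following holds. 1. $\check r$ is a linear subspace containing $\mathcal L^{\mathbb C}$. The projections $C:r\to\mathbb C^n$ and $\check C:\check r\to\mathbb C^n$, $(P,Q)\mapsto Q$, are bijective. There are unique complex-linear maps $P_-:\mathcal L^{\mathbb C}\to r_-$ with $X=P_-X+(P_-X)^*$ for all $X\in\mathcal L$ (this map is bijective), $\Pi:\check r\to\mathcal L^{\mathbb C}$ with $Y-\Pi Y\in r_\perp$ for all $Y\in\check r$, and $\mathcal P_-:\check r\to r$ equal to the identity on $r_\perp$ and to $P_-$ on $\mathcal L^{\mathbb C}$. 2. $\psi_D$ is Gaussian, $\psi_D(\xi)=\check c\,e^{\frac i2\xi\cdot\check A\xi}$, both pointwise (the integral over $\mathcal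 L$ converges absolutely for each $\xi\in\mathbb R^n$) and as a distribution on Schwartz functions. With $\check B:\check r\to\mathbb C^n$, $(P,Q)\mapsto P$, one has $\check A=\check B\check C^{-1}$. 3. The constant is $$\check c=c\int_{\mathcal L}d\mu(X)\,e^{-\frac i2\omega(X,\,C^{-1}\check CX)}=c\,(2\pi)^{k/2}\,\frac{\sqrt{\det T}}{\Delta(P_-)},\qquad T=\Pi\,\check C^{-1}C\,\mathcal P_-\big|_{\mathcal L^{\mathbb C}}:\mathcal L^{\mathbb C}\to\mathcal L^{\mathbb C},$$ where the integral converges absolutely, all eigenvalues of $T$ have positive real part and $\sqrt{\det T}$ is the product of their principal square roots (with algebraic multiplicity). Here $\Delta(P_-)=|\det P_{ij}|\,J'/J$, where $P_{ij}$ is the matrix of $P_-$ in any real basis $e$ of $\mathcal L$ and any complex basis $f$ of $r_-$, $J$ is the $\mu$-measure of the parallelepiped spanned by $e$, and $J'=\sqrt{\det\left(\frac1i\omega(f_a,f_b^*)\right)}$, i.e. $r_-$ is measured by its inner product $\frac1i\omega(Y,Y'^*)$. -/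

import Mathlib

open MeasureTheory Complex Matrix
open scoped SchwartzMap

noncomputable section

namespace LinearConstraint

/-- The phase space of pairs `(P, Q)` of momenta and coordinates, over `𝕜 = ℝ` (the classical phase
space) or `𝕜 = ℂ` (its complexification). Complex conjugation is `star`. -/
abbrev Phase (𝕜 : Type) (n : ℕ) : Type := (Fin n → 𝕜) × (Fin n → 𝕜)

/-- The symplectic form `ω((P,Q),(P',Q')) = ∑ⱼ (Pⱼ Q'ⱼ - P'ⱼ Qⱼ)`. -/
def omega {𝕜 : Type} [CommRing 𝕜] {n : ℕ} (X Y : Phase 𝕜 n) : 𝕜 := X.1 ⬝ᵥ Y.2 - Y.1 ⬝ᵥ X.2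

/-- The inclusion of the real phase space into its complexification. -/
def toC {n : ℕ} (X : Phase ℝ n) : Phase ℂ n := (fun j => (X.1 j : ℂ), fun j => (X.2 j : ℂ))

/-- The complexification `L^ℂ` of a real subspace. -/
def complexify {n : ℕ} (L : Submodule ℝ (Phase ℝ n)) : Submodule ℂ (Phase ℂ n) :=
  Submodule.span ℂ (toC '' (L : Set (Phase ℝ n)))

/-- A real vector of `L`, as an element of `L^ℂ`. -/
def inC {n : ℕ} (L : Submodule ℝ (Phase ℝ n)) (X : L) : complexify L :=
  ⟨toC (X : Phase ℝ n), Submodule.subset_span ⟨_, X.2, rfl⟩⟩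

/-- The skew-orthogonal complement with respect to `ω`. -/
def skewOrth {n : ℕ} (S : Submodule ℂ (Phase ℂ n)) : Submodule ℂ (Phase ℂ n) where
  carrier := {Y | ∀ X ∈ S, omega Y X = 0}
  zero_mem' := fun X _ => by simp [omega]
  add_mem' := fun {Y Z} hY hZ X hX => by
    have h1 := hY X hX
    have h2 := hZ X hX
    simp only [omega, Prod.fst_add, Prod.snd_add, add_dotProduct, dotProduct_add] at *
    linear_combination h1 + h2
  smul_mem' := fun a Y hY X hX => by
    have h1 := hY X hX
    simp only [omega, Prod.smul_fst, Prod.smul_snd, smul_dotProduct, dotProduct_smul,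
      smul_eq_mul] at *
    linear_combination a * h1

/-- The operator `Ω(P,Q) = ∑ⱼ (Pⱼ ξⱼ - Qⱼ (1/i) ∂/∂ξⱼ)`, for complex `(P,Q)`. -/
def Omega {n : ℕ} (Y : Phase ℂ n) (ψ : (Fin n → ℝ) → ℂ) (ξ : Fin n → ℝ) : ℂ :=
  ∑ j, (Y.1 j * (ξ j : ℂ) * ψ ξ - Y.2 j * ((1 / I) * fderiv ℝ ψ ξ (Pi.single j 1)))

/-- The operator `e^{iΩ(X)}` for real `X = (P,Q)`, in its explicit form
`(e^{iΩ(X)} ψ)(ξ) = e^{i (P·ξ - P·Q/2)} ψ(ξ - Q)`. -/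
def expOmega {n : ℕ} (X : Phase ℝ n) (ψ : (Fin n → ℝ) → ℂ) (ξ : Fin n → ℝ) : ℂ :=
  exp (I * ((X.1 ⬝ᵥ ξ - X.1 ⬝ᵥ X.2 / 2 : ℝ) : ℂ)) * ψ (ξ - X.2)

/-- The Weyl relation `e^{iΩ(X)} e^{iΩ(X')} = e^{iΩ(X+X')} e^{(i/2) ω(X,X')}`. -/
theorem expOmega_expOmega {n : ℕ} (X X' : Phase ℝ n) (ψ : (Fin n → ℝ) → ℂ) (ξ : Fin n → ℝ) :
    expOmega X (expOmega X' ψ) ξ =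
      expOmega (X + X') ψ ξ * exp (I / 2 * ((omega X X' : ℝ) : ℂ)) := by
  have h : ξ - X.2 - X'.2 = ξ - (X + X').2 := by simp [sub_sub]
  have h2 : X.1 ⬝ᵥ X'.2 = X'.2 ⬝ᵥ X.1 := dotProduct_comm _ _
  simp only [expOmega, h]
  rw [← mul_assoc, ← exp_add, mul_right_comm, ← exp_add]
  congr 2
  simp only [omega, Prod.fst_add, Prod.snd_add, add_dotProduct, dotProduct_add, dotProduct_sub]
  push_cast
  ring

/-- `s ↦ e^{iΩ(sX)} ψ` solves `d/ds u = i Ω(X) u`: the generator of the group is `Ω(X)`. -/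
theorem hasDerivAt_expOmega {n : ℕ} (X : Phase ℝ n) {ψ : (Fin n → ℝ) → ℂ}
    (hψ : Differentiable ℝ ψ) (ξ : Fin n → ℝ) (s : ℝ) :
    HasDerivAt (fun t : ℝ => expOmega (t • X) ψ ξ)
      (I * Omega (toC X) (expOmega (s • X) ψ) ξ) s := by
  have hsum : ∀ F : (Fin n → ℝ) → ℂ, Omega (toC X) F ξ =
      ((X.1 ⬝ᵥ ξ : ℝ) : ℂ) * F ξ + I * fderiv ℝ F ξ X.2 := fun F => by
    have hQ : fderiv ℝ F ξ X.2 = ∑ j, (X.2 j : ℂ) * fderiv ℝ F ξ (Pi.single j 1) := by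
      conv_lhs => rw [pi_eq_sum_univ' X.2, map_sum]
      refine Finset.sum_congr rfl fun j _ => ?_
      rw [map_smul, real_smul]
    rw [hQ]
    simp only [Omega, toC, dotProduct, ofReal_sum, ofReal_mul, Finset.sum_mul, Finset.mul_sum,
      ← Finset.sum_add_distrib, one_div, inv_I]
    exact Finset.sum_congr rfl fun j _ => by ring
  have hdiff : Differentiable ℝ (expOmega (s • X) ψ) := by
    unfold expOmega dotProduct
    fun_prop
  have hline : ∀ a b : ℝ, HasDerivAt (fun t : ℝ => ψ (ξ - a • X.2 + (b * t) • X.2))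
      (fderiv ℝ ψ (ξ - a • X.2) (b • X.2)) 0 := fun a b => by
    have h1 : HasDerivAt (fun t : ℝ => ξ - a • X.2 + (b * t) • X.2) (b • X.2) 0 := by
      have h2 : HasDerivAt (fun t : ℝ => (b * t)) b 0 := by
        simpa using (hasDerivAt_id (0 : ℝ)).const_mul b
      exact (h2.smul_const X.2).const_add _
    have h3 : HasFDerivAt ψ (fderiv ℝ ψ (ξ - a • X.2)) (ξ - a • X.2 + (b * 0) • X.2) := by
      simpa using (hψ (ξ - a • X.2)).hasFDerivAt
    exact h3.comp_hasDerivAt (0 : ℝ) h1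
  have hfd : fderiv ℝ (expOmega (s • X) ψ) ξ X.2 =
      exp (I * ((s * (X.1 ⬝ᵥ ξ) - s * s * (X.1 ⬝ᵥ X.2) / 2 : ℝ) : ℂ)) *
        (I * ((s * (X.1 ⬝ᵥ X.2) : ℝ) : ℂ) * ψ (ξ - s • X.2) +
          fderiv ℝ ψ (ξ - s • X.2) X.2) := by
    rw [← (hdiff ξ).lineDeriv_eq_fderiv, lineDeriv]
    have he : HasDerivAt (fun t : ℝ => exp (I * ((s * (X.1 ⬝ᵥ ξ) - s * s * (X.1 ⬝ᵥ X.2) / 2 +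
        t * (s * (X.1 ⬝ᵥ X.2)) : ℝ) : ℂ))) (exp (I * ((s * (X.1 ⬝ᵥ ξ) - s * s * (X.1 ⬝ᵥ X.2) / 2 +
        0 * (s * (X.1 ⬝ᵥ X.2)) : ℝ) : ℂ)) * (I * ((1 * (s * (X.1 ⬝ᵥ X.2)) : ℝ) : ℂ))) 0 :=
      ((((hasDerivAt_id (0 : ℝ)).mul_const _).const_add _).ofReal_comp.const_mul I).cexp
    have hp := (he.mul (hline s 1)).deriv
    refine Eq.trans (congrArg (fun g => deriv g (0 : ℝ)) ?_) (hp.trans ?_)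
    · funext t
      simp only [expOmega, Pi.mul_apply]
      congr 1
      · congr 3
        simp only [Prod.smul_fst, Prod.smul_snd, smul_dotProduct, dotProduct_smul, dotProduct_add,
          smul_eq_mul]
        ring
      · congr 1
        simp only [Prod.smul_snd, one_mul]
        abel
    · simp
      ring
  have hs : HasDerivAt (fun t : ℝ => expOmega ((s + t) • X) ψ ξ)
      (exp (I * ((s * (X.1 ⬝ᵥ ξ) - s * s * (X.1 ⬝ᵥ X.2) / 2 : ℝ) : ℂ)) *
        (I * ((X.1 ⬝ᵥ ξ - s * (X.1 ⬝ᵥ X.2) : ℝ) : ℂ) * ψ (ξ - s • X.2) -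
          fderiv ℝ ψ (ξ - s • X.2) X.2)) 0 := by
    have hr : HasDerivAt (fun t : ℝ => (s + t) * (X.1 ⬝ᵥ ξ) - (s + t) * (s + t) * (X.1 ⬝ᵥ X.2) / 2)
        (X.1 ⬝ᵥ ξ - s * (X.1 ⬝ᵥ X.2)) 0 := by
      have h0 : HasDerivAt (fun t : ℝ => s + t) 1 0 := (hasDerivAt_id (0 : ℝ)).const_add s
      refine ((h0.mul_const (X.1 ⬝ᵥ ξ)).sub
        (((h0.mul h0).mul_const (X.1 ⬝ᵥ X.2)).div_const 2)).congr_deriv ?_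
      ring
    have hp := ((hr.ofReal_comp.const_mul I).cexp).mul (hline s (-1))
    refine (hp.congr_deriv ?_).congr_of_eventuallyEq (Filter.Eventually.of_forall fun t => ?_)
    · simp
      ring
    · simp only [expOmega, Pi.mul_apply]
      congr 1
      · congr 3
        simp only [Prod.smul_fst, Prod.smul_snd, smul_dotProduct, dotProduct_smul, smul_eq_mul]
        ring
      · congr 1
        simp only [add_smul, neg_mul, one_mul, neg_smul, Prod.snd_add, Prod.smul_snd]
        abel
  have hfin := HasDerivAt.comp_sub_const s s (by simpa using hs)
  refine (hfin.congr_deriv ?_).congr_of_eventuallyEq (Filter.Eventually.of_forall fun t => ?_)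
  · rw [hsum, hfd]
    simp only [expOmega, Prod.smul_fst, Prod.smul_snd, smul_dotProduct, dotProduct_smul,
      smul_eq_mul, ← mul_assoc]
    push_cast
    linear_combination (-(exp (I * (s * ((X.1 ⬝ᵥ ξ : ℝ) : ℂ) - s * s * ((X.1 ⬝ᵥ X.2 : ℝ) : ℂ) / 2)) *
      (I * (s * ((X.1 ⬝ᵥ X.2 : ℝ) : ℂ)) * ψ (ξ - s • X.2) + fderiv ℝ ψ (ξ - s • X.2) X.2))) * I_mul_I
  · simp

/-- The Gaussian wave function `c e^{(i/2) ∑ⱼₖ ξⱼ Aⱼₖ ξₖ}`. -/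
def gaussian {n : ℕ} (c : ℂ) (A : Matrix (Fin n) (Fin n) ℂ) (ξ : Fin n → ℝ) : ℂ :=
  c * exp (I / 2 * ∑ j, ∑ l, (ξ j : ℂ) * A j l * (ξ l : ℂ))

/-- The inner product `(φ, ψ) = ∫ φ̄ ψ dξ`. -/
def pairing {n : ℕ} (φ ψ : (Fin n → ℝ) → ℂ) : ℂ := ∫ ξ, star (φ ξ) * ψ ξ

/-- The inner product `⟨φ, ψ⟩ = ∫_L dμ(X) (φ, e^{iΩ(X)} ψ)` of the algebraic approach. -/
def constrInner {n : ℕ} (L : Submodule ℝ (Phase ℝ n)) (μ : Measure L)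
    (φ ψ : (Fin n → ℝ) → ℂ) : ℂ :=
  ∫ X : L, pairing φ (expOmega (X : Phase ℝ n) ψ) ∂μ

/-- The S-germ `r = {Y | Ω(Y) ψ = 0}`. -/
def sGerm {n : ℕ} (ψ : (Fin n → ℝ) → ℂ) : Submodule ℂ (Phase ℂ n) where
  carrier := {Y | ∀ ξ, Omega Y ψ ξ = 0}
  zero_mem' := fun ξ => by simp [Omega]
  add_mem' := fun {Y Z} hY hZ ξ => by
    have h : Omega (Y + Z) ψ ξ = Omega Y ψ ξ + Omega Z ψ ξ := by
      simp only [Omega, ← Finset.sum_add_distrib]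
      refine Finset.sum_congr rfl fun j _ => ?_
      simp only [Prod.fst_add, Prod.snd_add, Pi.add_apply]
      ring
    rw [h, hY ξ, hZ ξ, add_zero]
  smul_mem' := fun a Y hY ξ => by
    have h : Omega (a • Y) ψ ξ = a * Omega Y ψ ξ := by
      simp only [Omega, Finset.mul_sum]
      refine Finset.sum_congr rfl fun j _ => ?_
      simp only [Prod.smul_fst, Prod.smul_snd, Pi.smul_apply, smul_eq_mul]
      ring
    rw [h, hY ξ, mul_zero]

/-- The H-germ `ř`: the `Y` skew-orthogonal to `L` (these are the `Y` for which `Ω(Y)` acts on the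
physical Hilbert space) such that `Ω(Y) ψ` has norm zero for the inner product `⟨·,·⟩`. -/
def hGerm {n : ℕ} (L : Submodule ℝ (Phase ℝ n)) (μ : Measure L) (ψ : (Fin n → ℝ) → ℂ) :
    Set (Phase ℂ n) :=
  {Y | Y ∈ skewOrth (complexify L) ∧ constrInner L μ (Omega Y ψ) (Omega Y ψ) = 0}

/-- `r_⊥ = r ∩ (L^ℂ)^{⊥ω}`. -/
def rPerp {n : ℕ} (L : Submodule ℝ (Phase ℝ n)) (ψ : (Fin n → ℝ) → ℂ) :
    Submodule ℂ (Phase ℂ n) :=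
  sGerm ψ ⊓ skewOrth (complexify L)

/-- `r₋`, the orthogonal complement of `r_⊥` in `r` with respect to the Hermitian form
`(1/i) ω(Y, Y'^*)`. -/
def rMinus {n : ℕ} (L : Submodule ℝ (Phase ℝ n)) (ψ : (Fin n → ℝ) → ℂ) :
    Submodule ℂ (Phase ℂ n) where
  carrier := {Y | Y ∈ sGerm ψ ∧ ∀ Y' ∈ rPerp L ψ, omega Y (star Y') = 0}
  zero_mem' := ⟨Submodule.zero_mem _, fun X _ => by simp [omega]⟩
  add_mem' := fun {Y Z} hY hZ => ⟨Submodule.add_mem _ hY.1 hZ.1, fun X hX => by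
    have h1 := hY.2 X hX
    have h2 := hZ.2 X hX
    simp only [omega, Prod.fst_add, Prod.snd_add, add_dotProduct, dotProduct_add] at *
    linear_combination h1 + h2⟩
  smul_mem' := fun a Y hY => ⟨Submodule.smul_mem _ _ hY.1, fun X hX => by
    have h1 := hY.2 X hX
    simp only [omega, Prod.smul_fst, Prod.smul_snd, smul_dotProduct, dotProduct_smul,
      smul_eq_mul] at *
    linear_combination a * h1⟩

theorem rMinus_le {n : ℕ} (L : Submodule ℝ (Phase ℝ n)) (ψ : (Fin n → ℝ) → ℂ) :
    rMinus L ψ ≤ sGerm ψ := fun _ h => h.1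

/-- The projection `(P,Q) ↦ P` of a subspace to the momenta plane. -/
def projP {n : ℕ} (R : Submodule ℂ (Phase ℂ n)) : R →ₗ[ℂ] (Fin n → ℂ) :=
  (LinearMap.fst ℂ (Fin n → ℂ) (Fin n → ℂ)).domRestrict R

/-- The projection `(P,Q) ↦ Q` of a subspace to the coordinate plane. -/
def projQ {n : ℕ} (R : Submodule ℂ (Phase ℂ n)) : R →ₗ[ℂ] (Fin n → ℂ) :=
  (LinearMap.snd ℂ (Fin n → ℂ) (Fin n → ℂ)).domRestrict R

/-- The inverse of the (bijective) projection to the coordinate plane. -/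
def projQInv {n : ℕ} {R : Submodule ℂ (Phase ℂ n)} (h : Function.Bijective (projQ R)) :
    (Fin n → ℂ) →ₗ[ℂ] R :=
  (LinearEquiv.ofBijective (projQ R) h).symm.toLinearMap

/-- `P₋ : L^ℂ → r₋` is the complex-linear map with `X = P₋ X + (P₋ X)^*` for all real `X ∈ L`. -/
def IsPMinus {n : ℕ} {L : Submodule ℝ (Phase ℝ n)} {ψ : (Fin n → ℝ) → ℂ}
    (Pm : complexify L →ₗ[ℂ] rMinus L ψ) : Prop :=
  ∀ X : L, toC (X : Phase ℝ n) =
    (Pm (inC L X) : Phase ℂ n) + star (Pm (inC L X) : Phase ℂ n)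

/-- `Π : ř → L^ℂ` is the linear map with `Y - Π Y ∈ r_⊥`. -/
def IsPi {n : ℕ} (L : Submodule ℝ (Phase ℝ n)) (ψ : (Fin n → ℝ) → ℂ)
    {R : Submodule ℂ (Phase ℂ n)} (Pr : R →ₗ[ℂ] complexify L) : Prop :=
  ∀ Y : R, (Y : Phase ℂ n) - (Pr Y : Phase ℂ n) ∈ rPerp L ψ

/-- `𝒫₋ : ř → r` is the linear map that is the identity on `r_⊥` and `P₋` on `L^ℂ`. -/
def IsCalPMinus {n : ℕ} {L : Submodule ℝ (Phase ℝ n)} {ψ : (Fin n → ℝ) → ℂ}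
    {R : Submodule ℂ (Phase ℂ n)} (Pm : complexify L →ₗ[ℂ] rMinus L ψ)
    (PP : R →ₗ[ℂ] sGerm ψ) : Prop :=
  (∀ Y : R, (Y : Phase ℂ n) ∈ rPerp L ψ → (PP Y : Phase ℂ n) = Y) ∧
  (∀ (Y : R) (hY : (Y : Phase ℂ n) ∈ complexify L), (PP Y : Phase ℂ n) = Pm ⟨Y, hY⟩)

/-- The Jacobian `Δ(P₋) = |det P_{ij}| J' / J` computed in a real basis `e` of `L` and a complex
basis `f` of `r₋`. Here `dμ = J dx₁ ⋯ dx_k`, i.e. `J` is the measure of the parallelepiped spanned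
by `e`; `r₋` carries the density of the inner product `(1/i) ω(Y, Y'^*)`, i.e. `J'` is the square
root of the Gram determinant of `f` (`J' = 1` when `f` is orthonormal). -/
def jacobianMinus {n k : ℕ} {L : Submodule ℝ (Phase ℝ n)} (μ : Measure L)
    {ψ : (Fin n → ℝ) → ℂ} (Pm : complexify L →ₗ[ℂ] rMinus L ψ)
    (e : Module.Basis (Fin k) ℝ L) (f : Module.Basis (Fin k) ℂ (rMinus L ψ)) : ℝ :=
  ‖(Matrix.of fun a b => f.repr (Pm (inC L (e b))) a).det‖ *
    Real.sqrt ‖(Matrix.of fun a b =>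
      (1 / I) * omega (f a : Phase ℂ n) (star (f b : Phase ℂ n))).det‖ /
    (μ (parallelepiped e)).toReal

/-- The branch of `√(det T)` given by the product of the principal square roots of the
eigenvalues of `T`, counted with algebraic multiplicity. -/
def sqrtDet {V : Type} [AddCommGroup V] [Module ℂ V] [Module.Finite ℂ V]
    (T : V →ₗ[ℂ] V) : ℂ :=
  (T.charpoly.roots.map fun z => z ^ (1 / 2 : ℂ)).prod

end LinearConstraint

end

open LinearConstraint

noncomputable section

namespace LinearConstraint

/-
The germ `r` of `ψ_A` is the graph of `A`, a Lagrangian plane on which `(1/i) ω(Y, Y'*)` is positive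
definite. Hence `ℂ²ⁿ = r ⊕ r*`, and `P₋` is the restriction to `L^ℂ` of the projection to `r`.
For `X ∈ L` the matrix element `(ψ_A, e^{iΩ(X)} ψ_A)` is a Gaussian in `X` whose matrix is the Gram
matrix of `P₋`. Integrating it by parts over `L` shows that the norm of `Ω(Y) ψ_A`, for `Y`
skew-orthogonal to `L`, only sees the component of `Y` in `r_⊥`, where it is `(1/i) ω(Y, Y*)` up to
a positive factor; so `ř = L^ℂ ⊕ r_⊥`, and a dimension count makes `ř` a graph.
Pointwise, `ψ_D(ξ)` is a Gaussian integral over `L` with some matrix `D`, completed to a square with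
the help of `Π`. Since `D [T]` is the Gram matrix of `P₋`, the value of the integral at `ξ = 0` is
read off from `det T`, the branch of the square root being followed along the segment from the Gram
matrix to `D`.
-/

section RealVectors

variable {ι : Type*}

/-- A real coordinate vector, regarded as a complex one. -/
def cvec (x : ι → ℝ) : ι → ℂ := fun j => (x j : ℂ)

@[simp] theorem cvec_apply (x : ι → ℝ) (j : ι) : cvec x j = (x j : ℂ) := rfl

theorem cvec_add (x y : ι → ℝ) : cvec (x + y) = cvec x + cvec y := by ext; simp

theorem cvec_sub (x y : ι → ℝ) : cvec (x - y) = cvec x - cvec y := by ext; simp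

theorem cvec_smul (a : ℝ) (x : ι → ℝ) : cvec (a • x) = (a : ℂ) • cvec x := by ext; simp

theorem cvec_single [DecidableEq ι] (j : ι) : cvec (Pi.single j 1) = Pi.single j 1 := by
  ext l
  by_cases h : l = j
  · subst h; simp
  · simp [h]

theorem star_cvec (x : ι → ℝ) : star (cvec x) = cvec x := by ext; simp

theorem eq_cvec_re_add_I_smul_cvec_im (v : ι → ℂ) :
    v = cvec (fun j => (v j).re) + I • cvec fun j => (v j).im := by
  ext j; simp [mul_comm I]

theorem isSymm_map_ofReal {B : Matrix ι ι ℝ} (hB : B.PosDef) : (B.map ofReal).IsSymm := by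
  have : Bᵀ = B := by simpa using hB.isHermitian.eq
  rw [IsSymm, ← transpose_map, this]

theorem map_re_map_ofReal (B : Matrix ι ι ℝ) : (B.map ofReal).map re = B := by ext; simp

variable [Fintype ι]

theorem cvec_dotProduct (x y : ι → ℝ) : cvec x ⬝ᵥ cvec y = ((x ⬝ᵥ y : ℝ) : ℂ) :=
  (RingHom.map_dotProduct ofRealHom x y).symm

theorem map_ofReal_mulVec_cvec (G : Matrix ι ι ℝ) (x : ι → ℝ) :
    G.map ofReal *ᵥ cvec x = cvec (G *ᵥ x) :=
  funext fun i => (RingHom.map_mulVec ofRealHom G x i).symm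

theorem det_map_ofReal [DecidableEq ι] (G : Matrix ι ι ℝ) :
    (G.map ofReal).det = ((G.det : ℝ) : ℂ) :=
  (RingHom.map_det ofRealHom G).symm

theorem transpose_mul_mul_map_ofReal (G N : Matrix ι ι ℝ) :
    (G.map ofReal)ᵀ * N.map ofReal * G.map ofReal = (Gᵀ * N * G).map ofReal :=
  ((Matrix.map_mul (f := ofRealHom)).trans
    (congrArg (· * G.map ofRealHom) (Matrix.map_mul (f := ofRealHom)))).symm

end RealVectors

section PositiveDefinite

variable {ι : Type*} [Fintype ι]

theorem dotProduct_mulVec_comm {R : Type*} [CommRing R] {S : Matrix ι ι R} (hS : S.IsSymm)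
    (u v : ι → R) : u ⬝ᵥ S *ᵥ v = v ⬝ᵥ S *ᵥ u := by
  rw [dotProduct_mulVec, ← mulVec_transpose, hS.eq, dotProduct_comm]

theorem dotProduct_mulVec_pos {R : Matrix ι ι ℝ} (hR : R.PosDef) {x : ι → ℝ} (hx : x ≠ 0) :
    0 < x ⬝ᵥ R *ᵥ x := by
  simpa only [star_trivial] using hR.dotProduct_mulVec_pos hx

theorem re_dotProduct_mulVec_cvec (S : Matrix ι ι ℂ) (x : ι → ℝ) :
    (cvec x ⬝ᵥ S *ᵥ cvec x).re = x ⬝ᵥ S.map re *ᵥ x := by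
  simp [dotProduct, mulVec, Complex.re_sum]

theorem star_dotProduct_mulVec_of_isSymm {S : Matrix ι ι ℂ} (hS : S.IsSymm) (v : ι → ℂ) :
    star v ⬝ᵥ S *ᵥ v = (cvec fun j => (v j).re) ⬝ᵥ S *ᵥ (cvec fun j => (v j).re) +
      (cvec fun j => (v j).im) ⬝ᵥ S *ᵥ (cvec fun j => (v j).im) := by
  set x : ι → ℝ := fun j => (v j).re
  set y : ι → ℝ := fun j => (v j).im
  have hv : v = cvec x + I • cvec y := eq_cvec_re_add_I_smul_cvec_im v
  have hstar : star v = cvec x - I • cvec y := by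
    rw [hv, star_add, star_smul, star_cvec, star_cvec, star_def, conj_I, neg_smul, sub_eq_add_neg]
  rw [hstar, hv]
  simp only [mulVec_add, mulVec_smul, dotProduct_add, sub_dotProduct, dotProduct_smul,
    smul_dotProduct, smul_eq_mul]
  rw [dotProduct_mulVec_comm hS (cvec y) (cvec x)]
  linear_combination (-(cvec y ⬝ᵥ S *ᵥ cvec y)) * I_mul_I

theorem re_star_dotProduct_mulVec_pos {S : Matrix ι ι ℂ} (hS : S.IsSymm)
    (hre : (S.map re).PosDef) {v : ι → ℂ} (hv : v ≠ 0) : 0 < (star v ⬝ᵥ S *ᵥ v).re := by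
  rw [star_dotProduct_mulVec_of_isSymm hS, add_re, re_dotProduct_mulVec_cvec,
    re_dotProduct_mulVec_cvec]
  have hnonneg : ∀ u : ι → ℝ, 0 ≤ u ⬝ᵥ S.map re *ᵥ u := fun u => by
    simpa only [star_trivial] using hre.posSemidef.dotProduct_mulVec_nonneg u
  by_cases hx : (fun j => (v j).re) = 0
  · have hy : (fun j => (v j).im) ≠ 0 := fun hy =>
      hv (funext fun j => Complex.ext (congrFun hx j) (congrFun hy j))
    linarith [hnonneg fun j => (v j).re, dotProduct_mulVec_pos hre hy]
  · linarith [hnonneg fun j => (v j).im, dotProduct_mulVec_pos hre hx]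

theorem exists_eq_transpose_mul_self [DecidableEq ι] {R : Matrix ι ι ℝ} (hR : R.PosDef) :
    ∃ B : Matrix ι ι ℝ, IsUnit B.det ∧ R = Bᵀ * B := by
  open scoped MatrixOrder in
  obtain ⟨B, hB⟩ := CStarAlgebra.nonneg_iff_eq_star_mul_self.mp hR.posSemidef.nonneg
  rw [star_eq_conjTranspose, conjTranspose_eq_transpose_of_trivial] at hB
  refine ⟨B, isUnit_iff_ne_zero.2 fun h0 => hR.det_pos.ne' ?_, hB⟩
  rw [hB, det_mul, h0, mul_zero]

theorem exists_mul_norm_sq_le {R : Matrix ι ι ℝ} (hR : R.PosDef) :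
    ∃ m > 0, ∀ x : ι → ℝ, m * ‖x‖ ^ 2 ≤ x ⬝ᵥ R *ᵥ x := by
  classical
  obtain ⟨B, hB, rfl⟩ := exists_eq_transpose_mul_self hR
  obtain ⟨K, hK, hanti⟩ := LinearMap.exists_antilipschitzWith B.mulVecLin
    (LinearMap.ker_eq_bot.2 (mulVec_injective_iff_isUnit.2 ((isUnit_iff_isUnit_det B).2 hB)))
  refine ⟨((K : ℝ) ^ 2)⁻¹, by positivity, fun x => ?_⟩
  have hle : ‖x‖ ≤ K * ‖B *ᵥ x‖ := hanti.le_mul_norm (map_zero B.mulVecLin) x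
  have hsup : ‖B *ᵥ x‖ ≤ √(B *ᵥ x ⬝ᵥ B *ᵥ x) :=
    (pi_norm_le_iff_of_nonneg (Real.sqrt_nonneg _)).2 fun j => Real.abs_le_sqrt <| by
      rw [sq]
      exact Finset.single_le_sum (f := fun j => (B *ᵥ x) j * (B *ᵥ x) j)
        (fun i _ => mul_self_nonneg _) (Finset.mem_univ j)
  have hsq : 0 ≤ B *ᵥ x ⬝ᵥ B *ᵥ x := Finset.sum_nonneg fun i _ => mul_self_nonneg _
  calc ((K : ℝ) ^ 2)⁻¹ * ‖x‖ ^ 2 ≤ ((K : ℝ) ^ 2)⁻¹ * (K * √(B *ᵥ x ⬝ᵥ B *ᵥ x)) ^ 2 := by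
        gcongr
        exact hle.trans (by gcongr)
    _ = B *ᵥ x ⬝ᵥ B *ᵥ x := by
        rw [mul_pow, Real.sq_sqrt hsq]
        field_simp
    _ = x ⬝ᵥ (Bᵀ * B) *ᵥ x := by
        rw [← mulVec_mulVec, dotProduct_mulVec x, vecMul_transpose]

variable [DecidableEq ι]

theorem exists_orthogonal_diagonal {N : Matrix ι ι ℝ} (hN : N.IsSymm) :
    ∃ (U : Matrix ι ι ℝ) (d : ι → ℝ), Uᵀ * U = 1 ∧ Uᵀ * N * U = diagonal d := by
  have hH : N.IsHermitian := (conjTranspose_eq_transpose_of_trivial N).trans hN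
  refine ⟨hH.eigenvectorUnitary, hH.eigenvalues, ?_, ?_⟩
  · have := Unitary.coe_star_mul_self hH.eigenvectorUnitary
    rwa [star_eq_conjTranspose, conjTranspose_eq_transpose_of_trivial] at this
  · have := hH.conjStarAlgAut_star_eigenvectorUnitary
    rw [Unitary.conjStarAlgAut_star_apply, star_eq_conjTranspose,
      conjTranspose_eq_transpose_of_trivial] at this
    simpa [Function.comp_def] using this

theorem exists_congruence_diagonal {R K : Matrix ι ι ℝ} (hR : R.PosDef) (hK : K.IsSymm) :
    ∃ (G : Matrix ι ι ℝ) (d : ι → ℝ), IsUnit G.det ∧ Gᵀ * R * G = 1 ∧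
      Gᵀ * K * G = diagonal d := by
  obtain ⟨B, hB, rfl⟩ := exists_eq_transpose_mul_self hR
  have hsymm : (B⁻¹ᵀ * K * B⁻¹).IsSymm := by
    simp only [IsSymm, transpose_mul, transpose_transpose, hK.eq, Matrix.mul_assoc]
  obtain ⟨V, d, hV, hVK⟩ := exists_orthogonal_diagonal hsymm
  have hBV : B * (B⁻¹ * V) = V := by rw [← Matrix.mul_assoc, mul_nonsing_inv B hB, Matrix.one_mul]
  have hR1 : (B⁻¹ * V)ᵀ * (Bᵀ * B) * (B⁻¹ * V) = 1 := by
    calc (B⁻¹ * V)ᵀ * (Bᵀ * B) * (B⁻¹ * V) = (B * (B⁻¹ * V))ᵀ * (B * (B⁻¹ * V)) := by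
          simp only [transpose_mul, Matrix.mul_assoc]
      _ = 1 := by rw [hBV, hV]
  refine ⟨B⁻¹ * V, d, ?_, hR1, ?_⟩
  · exact (isUnit_iff_isUnit_det _).1 (IsUnit.of_mul_eq_one_right _ hR1)
  · rw [← hVK]
    simp only [transpose_mul, Matrix.mul_assoc]

theorem exists_congruence_diagonal_of_posDef_re {S : Matrix ι ι ℂ} (hS : S.IsSymm)
    (hre : (S.map re).PosDef) :
    ∃ (G : Matrix ι ι ℝ) (δ : ι → ℂ), IsUnit G.det ∧ (∀ j, 0 < (δ j).re) ∧
      (G.map ofReal)ᵀ * S * G.map ofReal = diagonal δ := by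
  have hK : (S.map im).IsSymm := by rw [IsSymm, ← transpose_map, hS.eq]
  obtain ⟨G, d, hG, h1, h2⟩ := exists_congruence_diagonal hre hK
  refine ⟨G, fun j => 1 + I * d j, hG, fun j => by simp, ?_⟩
  have hdec : S = (S.map re).map ofReal + I • (S.map im).map ofReal := by
    ext i j
    simp [mul_comm I]
  conv_lhs => rw [hdec]
  rw [Matrix.mul_add, Matrix.add_mul, mul_smul_comm, Matrix.smul_mul,
    transpose_mul_mul_map_ofReal, transpose_mul_mul_map_ofReal, h1, h2]
  ext i j
  by_cases hij : i = j
  · subst hij; simp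
  · simp [hij]

end PositiveDefinite

section GaussianFunctions

variable {ι : Type*} [Fintype ι]

/-- The Gaussian `e^{-½ x·Sx + i b·x}`, the common shape of all integrands below: wave functions
in the variable `ξ ∈ ℝⁿ` and orbits of `L` in linear coordinates `x ∈ ℝᵏ`. -/
def gaussExp (S : Matrix ι ι ℂ) (b : ι → ℂ) (x : ι → ℝ) : ℂ :=
  Complex.exp (-(1 / 2) * (cvec x ⬝ᵥ S *ᵥ cvec x) + I * (b ⬝ᵥ cvec x))

@[fun_prop]
theorem contDiff_gaussExp (S : Matrix ι ι ℂ) (b : ι → ℂ) : ContDiff ℝ 1 (gaussExp S b) := by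
  unfold gaussExp dotProduct mulVec dotProduct cvec
  have : ∀ j, ContDiff ℝ 1 fun x : ι → ℝ => (x j : ℂ) := fun j =>
    ofRealCLM.contDiff.comp (contDiff_apply ℝ ℝ j)
  fun_prop

@[fun_prop]
theorem continuous_gaussExp (S : Matrix ι ι ℂ) (b : ι → ℂ) : Continuous (gaussExp S b) :=
  (contDiff_gaussExp S b).continuous

theorem differentiable_gaussExp (S : Matrix ι ι ℂ) (b : ι → ℂ) :
    Differentiable ℝ (gaussExp S b) :=
  (contDiff_gaussExp S b).differentiable one_ne_zero

theorem norm_gaussExp (S : Matrix ι ι ℂ) (b : ι → ℂ) (x : ι → ℝ) :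
    ‖gaussExp S b x‖ = Real.exp (-(1 / 2) * (x ⬝ᵥ S.map re *ᵥ x) - (fun j => (b j).im) ⬝ᵥ x) := by
  have him : (b ⬝ᵥ cvec x).im = (fun j => (b j).im) ⬝ᵥ x := by simp [dotProduct, Complex.im_sum]
  have hhalf : (-(1 / 2) : ℂ) = ((-(1 / 2) : ℝ) : ℂ) := by push_cast; rfl
  rw [gaussExp, norm_exp, add_re, ← re_dotProduct_mulVec_cvec, ← him, hhalf, re_ofReal_mul,
    I_mul_re, sub_eq_add_neg]

theorem gaussExp_add_smul {S : Matrix ι ι ℂ} (hS : S.IsSymm) (b : ι → ℂ) (x v : ι → ℝ) (t : ℝ) :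
    gaussExp S b (x + t • v) = Complex.exp
      (-(1 / 2) * (cvec x ⬝ᵥ S *ᵥ cvec x) + I * (b ⬝ᵥ cvec x) +
        (t : ℂ) * (-(cvec v ⬝ᵥ S *ᵥ cvec x) + I * (b ⬝ᵥ cvec v)) +
        (t : ℂ) ^ 2 * (-(1 / 2) * (cvec v ⬝ᵥ S *ᵥ cvec v))) := by
  rw [gaussExp]
  congr 1
  simp only [cvec_add, cvec_smul, mulVec_add, mulVec_smul, dotProduct_add, add_dotProduct,
    dotProduct_smul, smul_dotProduct, smul_eq_mul]
  rw [dotProduct_mulVec_comm hS (cvec x) (cvec v)]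
  ring

theorem fderiv_gaussExp {S : Matrix ι ι ℂ} (hS : S.IsSymm) (b : ι → ℂ) (x v : ι → ℝ) :
    fderiv ℝ (gaussExp S b) x v =
      (-(cvec v ⬝ᵥ S *ᵥ cvec x) + I * (b ⬝ᵥ cvec v)) * gaussExp S b x := by
  have hcoe : HasDerivAt (fun t : ℝ => (t : ℂ)) 1 0 := (hasDerivAt_id (0 : ℝ)).ofReal_comp
  have hline := (((hcoe.mul_const (-(cvec v ⬝ᵥ S *ᵥ cvec x) + I * (b ⬝ᵥ cvec v))).const_add
    (-(1 / 2) * (cvec x ⬝ᵥ S *ᵥ cvec x) + I * (b ⬝ᵥ cvec x))).add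
    ((hcoe.pow 2).mul_const (-(1 / 2) * (cvec v ⬝ᵥ S *ᵥ cvec v)))).cexp
  rw [← (differentiable_gaussExp S b x).lineDeriv_eq_fderiv, lineDeriv]
  refine (HasDerivAt.congr_deriv (hline.congr_of_eventuallyEq (.of_forall fun t =>
    gaussExp_add_smul hS b x v t)) ?_).deriv
  simp [gaussExp, mul_comm]

theorem exists_abs_dotProduct_le (v : ι → ℝ) : ∃ M, ∀ x : ι → ℝ, |v ⬝ᵥ x| ≤ M * ‖x‖ := by
  refine ⟨∑ j, |v j|, fun x => ?_⟩
  rw [dotProduct, Finset.sum_mul]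
  refine (Finset.abs_sum_le_sum_abs _ _).trans (Finset.sum_le_sum fun j _ => ?_)
  rw [abs_mul]
  gcongr
  exact norm_le_pi_norm x j

theorem exists_norm_gaussExp_le {S : Matrix ι ι ℂ} (hS : (S.map re).PosDef) (b : ι → ℂ) (N : ℕ) :
    ∃ C, ∀ x, (1 + ‖x‖) ^ N * ‖gaussExp S b x‖ ≤ C := by
  obtain ⟨m, hm, hle⟩ := exists_mul_norm_sq_le hS
  obtain ⟨M, hb⟩ := exists_abs_dotProduct_le fun j => (b j).im
  refine ⟨Real.exp ((M + N) ^ 2 / (2 * m)), fun x => ?_⟩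
  have hpow : (1 + ‖x‖) ^ N ≤ Real.exp (N * ‖x‖) := by
    rw [Real.exp_nat_mul]
    gcongr
    linarith [Real.add_one_le_exp ‖x‖]
  rw [norm_gaussExp]
  refine (mul_le_mul_of_nonneg_right hpow (Real.exp_nonneg _)).trans ?_
  rw [← Real.exp_add, Real.exp_le_exp, le_div_iff₀ (by positivity)]
  have hquad := hle x
  have hlin := neg_le_of_abs_le (hb x)
  nlinarith [sq_nonneg (M + N - m * ‖x‖), norm_nonneg x]

theorem integrable_mul_gaussExp {S : Matrix ι ι ℂ} (hS : (S.map re).PosDef) (b : ι → ℂ)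
    {f : (ι → ℝ) → ℂ} (hf : f.HasTemperateGrowth) : Integrable fun x => f x * gaussExp S b x := by
  obtain ⟨k, C, hC, hle⟩ := hf.norm_iteratedFDeriv_le_uniform 0
  obtain ⟨C', hle'⟩ := exists_norm_gaussExp_le hS b (k + (Fintype.card ι + 1))
  have hint : Integrable fun x : ι → ℝ => C * C' * (1 + ‖x‖) ^ (-((Fintype.card ι + 1 : ℕ) : ℝ)) :=
    (integrable_one_add_norm (by simp)).const_mul _
  refine hint.mono' (hf.1.continuous.mul (continuous_gaussExp S b)).aestronglyMeasurable
    (.of_forall fun x => ?_)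
  have hfx : ‖f x‖ ≤ C * (1 + ‖x‖) ^ k :=
    norm_iteratedFDeriv_zero (𝕜 := ℝ) (f := f) ▸ hle 0 le_rfl x
  have h0 : 0 < 1 + ‖x‖ := by positivity
  rw [norm_mul, Real.rpow_neg h0.le, Real.rpow_natCast, ← div_eq_mul_inv,
    le_div_iff₀ (by positivity)]
  calc ‖f x‖ * ‖gaussExp S b x‖ * (1 + ‖x‖) ^ (Fintype.card ι + 1)
      ≤ C * (1 + ‖x‖) ^ k * ‖gaussExp S b x‖ * (1 + ‖x‖) ^ (Fintype.card ι + 1) := by gcongr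
    _ = C * ((1 + ‖x‖) ^ (k + (Fintype.card ι + 1)) * ‖gaussExp S b x‖) := by ring
    _ ≤ C * C' := by gcongr; exact hle' x

theorem integrable_gaussExp {S : Matrix ι ι ℂ} (hS : (S.map re).PosDef) (b : ι → ℂ) :
    Integrable (gaussExp S b) := by
  simpa only [one_mul] using
    integrable_mul_gaussExp hS b (Function.HasTemperateGrowth.const (1 : ℂ))

@[fun_prop]
theorem hasTemperateGrowth_dotProduct_cvec (w : ι → ℂ) :
    Function.HasTemperateGrowth fun x : ι → ℝ => w ⬝ᵥ cvec x := by
  unfold dotProduct cvec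
  have : ∀ j, Function.HasTemperateGrowth fun x : ι → ℝ => (x j : ℂ) := fun j =>
    (ofRealCLM ∘L ContinuousLinearMap.proj (R := ℝ) (φ := fun _ : ι => ℝ) j).hasTemperateGrowth
  fun_prop

@[fun_prop]
theorem hasTemperateGrowth_dotProduct_mulVec_cvec (w : ι → ℂ) (S : Matrix ι ι ℂ) :
    Function.HasTemperateGrowth fun x : ι → ℝ => w ⬝ᵥ S *ᵥ cvec x := by
  simp only [dotProduct_mulVec]
  fun_prop

end GaussianFunctions

section GaussianIntegral

variable {ι : Type*} [Fintype ι]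

/-- The Gaussian integral `∫ e^{-½ x·Sx} dx`. -/
def gaussConst (S : Matrix ι ι ℂ) : ℂ := ∫ x, gaussExp S 0 x

theorem integral_comp_mulVec [DecidableEq ι] {G : Matrix ι ι ℝ} (hG : G.det ≠ 0) {f : (ι → ℝ) → ℂ}
    (hf : Continuous f) : ∫ x, f x = |G.det| * ∫ y, f (G *ᵥ y) := by
  have hmap : ∫ y, f (G *ᵥ y) = ∫ x, f x ∂(Measure.map (toLin' G) volume) :=
    (integral_map (φ := toLin' G) (LinearMap.continuous_of_finiteDimensional _).aemeasurable
      hf.aestronglyMeasurable).symm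
  rw [hmap, Real.map_matrix_volume_pi_eq_smul_volume_pi hG, integral_smul_measure,
    ENNReal.toReal_ofReal (abs_nonneg _), abs_inv, real_smul, ← mul_assoc, ← ofReal_mul,
    mul_inv_cancel₀ (abs_ne_zero.2 hG), ofReal_one, one_mul]

theorem gaussExp_mulVec [DecidableEq ι] {S : Matrix ι ι ℂ} {G : Matrix ι ι ℝ} {δ : ι → ℂ}
    (h : (G.map ofReal)ᵀ * S * G.map ofReal = diagonal δ) (b : ι → ℂ) (y : ι → ℝ) :
    gaussExp S b (G *ᵥ y) = Complex.exp (-∑ j, δ j / 2 * (y j : ℂ) ^ 2 +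
      ∑ j, I * (b ᵥ* G.map ofReal) j * y j) := by
  have hquad : cvec (G *ᵥ y) ⬝ᵥ S *ᵥ cvec (G *ᵥ y) = ∑ j, δ j * (y j : ℂ) ^ 2 := by
    rw [← map_ofReal_mulVec_cvec, ← vecMul_transpose, ← dotProduct_mulVec, vecMul_transpose,
      mulVec_mulVec, mulVec_mulVec, h]
    exact Finset.sum_congr rfl fun j _ => by rw [mulVec_diagonal, cvec_apply]; ring
  have hlin : b ⬝ᵥ cvec (G *ᵥ y) = ∑ j, (b ᵥ* G.map ofReal) j * y j := by
    rw [← map_ofReal_mulVec_cvec, dotProduct_mulVec]; rfl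
  rw [gaussExp, hquad, hlin, Finset.mul_sum, Finset.mul_sum, ← Finset.sum_neg_distrib]
  congr 2 <;> exact Finset.sum_congr rfl fun j _ => by ring

theorem integral_gaussExp_of_diagonal [DecidableEq ι] {S : Matrix ι ι ℂ} {G : Matrix ι ι ℝ}
    {δ : ι → ℂ} (hG : IsUnit G.det) (hδ : ∀ j, 0 < (δ j).re)
    (h : (G.map ofReal)ᵀ * S * G.map ofReal = diagonal δ) (b : ι → ℂ) :
    ∫ x, gaussExp S b x = |G.det| * (∏ j, (2 * Real.pi / δ j) ^ (1 / 2 : ℂ)) *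
      Complex.exp (-(1 / 2) * ∑ j, (b ᵥ* G.map ofReal) j ^ 2 / δ j) := by
  have hδ2 : ∀ j, 0 < (δ j / 2).re := fun j => by
    rw [show δ j / 2 = ((1 / 2 : ℝ) : ℂ) * δ j by push_cast; ring, re_ofReal_mul]
    exact mul_pos one_half_pos (hδ j)
  rw [integral_comp_mulVec hG.ne_zero (continuous_gaussExp S b)]
  simp only [gaussExp_mulVec h]
  rw [GaussianFourier.integral_cexp_neg_sum_mul_add hδ2, Finset.prod_mul_distrib,
    ← Complex.exp_sum, mul_assoc]
  congr 3
  · ext j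
    rw [div_div_eq_mul_div, mul_comm]
  · rw [Finset.mul_sum]
    refine Finset.sum_congr rfl fun j _ => ?_
    have : δ j ≠ 0 := fun h0 => by simpa [h0] using hδ j
    rw [mul_pow, I_sq]
    field_simp
    ring

-- Phrasing the exponent through a solution of `S z = b` keeps `S⁻¹` out of the formulas.
theorem integral_gaussExp {S : Matrix ι ι ℂ} (hS : S.IsSymm) (hre : (S.map re).PosDef)
    {b z : ι → ℂ} (hz : S *ᵥ z = b) :
    ∫ x, gaussExp S b x = gaussConst S * Complex.exp (-(1 / 2) * (b ⬝ᵥ z)) := by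
  classical
  obtain ⟨G, δ, hG, hδ, h⟩ := exists_congruence_diagonal_of_posDef_re hS hre
  have hGc : IsUnit (G.map ofReal).det := by
    rw [det_map_ofReal]
    exact isUnit_iff_ne_zero.2 (ofReal_ne_zero.2 hG.ne_zero)
  obtain ⟨w, rfl⟩ : ∃ w, z = G.map ofReal *ᵥ w :=
    ⟨(G.map ofReal)⁻¹ *ᵥ z, by rw [mulVec_mulVec, mul_nonsing_inv _ hGc, one_mulVec]⟩
  have hc : ∀ j, (b ᵥ* G.map ofReal) j = δ j * w j := fun j => by
    rw [← mulVec_transpose, ← hz, mulVec_mulVec, mulVec_mulVec, h, mulVec_diagonal]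
  have hsum : ∑ j, (b ᵥ* G.map ofReal) j ^ 2 / δ j = b ⬝ᵥ G.map ofReal *ᵥ w := by
    rw [dotProduct_mulVec, dotProduct]
    refine Finset.sum_congr rfl fun j _ => ?_
    have : δ j ≠ 0 := fun h0 => by simpa [h0] using hδ j
    rw [hc j]
    field_simp
  rw [gaussConst, integral_gaussExp_of_diagonal hG hδ h, integral_gaussExp_of_diagonal hG hδ h,
    hsum]
  simp

theorem cpow_half_sq (z : ℂ) : (z ^ (1 / 2 : ℂ)) ^ 2 = z := by
  simpa only [one_div, Nat.cast_ofNat] using cpow_nat_inv_pow z two_ne_zero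

theorem gaussConst_sq_mul_det [DecidableEq ι] {S : Matrix ι ι ℂ} (hS : S.IsSymm)
    (hre : (S.map re).PosDef) :
    gaussConst S ^ 2 * S.det = (2 * Real.pi) ^ Fintype.card ι := by
  obtain ⟨G, δ, hG, hδ, h⟩ := exists_congruence_diagonal_of_posDef_re hS hre
  have hδ0 : ∀ j, δ j ≠ 0 := fun j h0 => by simpa [h0] using hδ j
  have hdet : (G.det : ℂ) ^ 2 * S.det = ∏ j, δ j := by
    rw [← det_diagonal, ← h, det_mul, det_mul, det_transpose, det_map_ofReal]
    ring
  have habs : ((|G.det| : ℝ) : ℂ) ^ 2 = (G.det : ℂ) ^ 2 := by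
    rw [← ofReal_pow, sq_abs, ofReal_pow]
  have hval : gaussConst S = |G.det| * ∏ j, (2 * Real.pi / δ j) ^ (1 / 2 : ℂ) := by
    simp [gaussConst, integral_gaussExp_of_diagonal hG hδ h]
  calc gaussConst S ^ 2 * S.det
      = (∏ j, (2 * Real.pi / δ j : ℂ)) * ((G.det : ℂ) ^ 2 * S.det) := by
        rw [hval, mul_pow, habs, ← Finset.prod_pow,
          Finset.prod_congr rfl fun j _ => cpow_half_sq _]
        ring
    _ = ∏ j, (2 * Real.pi / δ j : ℂ) * δ j := by rw [hdet, Finset.prod_mul_distrib]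
    _ = (2 * Real.pi) ^ Fintype.card ι := by
        rw [Finset.prod_congr rfl fun j _ => div_mul_cancel₀ _ (hδ0 j)]
        simp

theorem gaussConst_ne_zero {S : Matrix ι ι ℂ} (hS : S.IsSymm) (hre : (S.map re).PosDef) :
    gaussConst S ≠ 0 := fun h0 => by
  classical
  have hsq := gaussConst_sq_mul_det hS hre
  rw [h0, zero_pow two_ne_zero, zero_mul] at hsq
  exact pow_ne_zero _ (by simp [Real.pi_ne_zero]) hsq.symm

theorem gaussConst_ofReal [DecidableEq ι] {B : Matrix ι ι ℝ} (hB : B.PosDef) :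
    gaussConst (B.map ofReal) =
      (((2 * Real.pi) ^ ((Fintype.card ι : ℝ) / 2) / √B.det : ℝ) : ℂ) := by
  have hval : ∀ x, gaussExp (B.map ofReal) 0 x =
      ((Real.exp (-(1 / 2) * (x ⬝ᵥ B *ᵥ x)) : ℝ) : ℂ) := fun x => by
    rw [gaussExp, map_ofReal_mulVec_cvec, cvec_dotProduct]
    simp
  have hreal : gaussConst (B.map ofReal) =
      ((∫ x, Real.exp (-(1 / 2) * (x ⬝ᵥ B *ᵥ x)) : ℝ) : ℂ) :=
    (integral_congr_ae (.of_forall hval)).trans integral_ofReal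
  have hsq := gaussConst_sq_mul_det (isSymm_map_ofReal hB) ((map_re_map_ofReal B).symm ▸ hB)
  rw [hreal, det_map_ofReal] at hsq
  rw [hreal]
  norm_cast at hsq ⊢
  have hd := hB.det_pos
  have hpi : (0 : ℝ) ≤ 2 * Real.pi := by positivity
  rw [← pow_left_inj₀ (integral_nonneg fun x => (Real.exp_pos _).le) (by positivity)
    (two_ne_zero), div_pow, Real.sq_sqrt hd.le, eq_div_iff hd.ne', hsq, ← Real.rpow_natCast,
    ← Real.rpow_natCast, ← Real.rpow_mul hpi]
  congr 1
  push_cast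
  ring

end GaussianIntegral

section SquareRootBranch

variable {ι : Type*}

/-- The segment from the real matrix `B` (at `t = 0`) to `S` (at `t = 1`), along which the branch
of the square root in a Gaussian integral is followed. -/
def segmentMatrix (B : Matrix ι ι ℝ) (S : Matrix ι ι ℂ) (t : ℝ) : Matrix ι ι ℂ :=
  (1 - t : ℂ) • B.map ofReal + (t : ℂ) • S

theorem segmentMatrix_zero (B : Matrix ι ι ℝ) (S : Matrix ι ι ℂ) :
    segmentMatrix B S 0 = B.map ofReal := by simp [segmentMatrix]

theorem segmentMatrix_one (B : Matrix ι ι ℝ) (S : Matrix ι ι ℂ) : segmentMatrix B S 1 = S := by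
  simp [segmentMatrix]

theorem map_re_segmentMatrix (B : Matrix ι ι ℝ) (S : Matrix ι ι ℂ) (t : ℝ) :
    (segmentMatrix B S t).map re = (1 - t) • B + t • S.map re := by
  ext i j; simp [segmentMatrix]

theorem isSymm_segmentMatrix {B : Matrix ι ι ℝ} {S : Matrix ι ι ℂ} (hB : B.PosDef) (hS : S.IsSymm)
    (t : ℝ) : (segmentMatrix B S t).IsSymm :=
  ((isSymm_map_ofReal hB).smul _).add (hS.smul _)

theorem posDef_re_segmentMatrix {B : Matrix ι ι ℝ} {S : Matrix ι ι ℂ} (hB : B.PosDef)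
    (hre : (S.map re).PosDef) {t : ℝ} (ht : t ∈ Set.Icc (0 : ℝ) 1) :
    ((segmentMatrix B S t).map re).PosDef := by
  rw [map_re_segmentMatrix]
  rcases ht.1.eq_or_lt with rfl | h
  · simpa using hB
  · exact PosDef.posSemidef_add (hB.posSemidef.smul (sub_nonneg.2 ht.2)) (hre.smul h)

variable [Fintype ι]

theorem norm_gaussExp_segmentMatrix_le (B : Matrix ι ι ℝ) (S : Matrix ι ι ℂ) {t : ℝ}
    (ht : t ∈ Set.Icc (0 : ℝ) 1) (x : ι → ℝ) :
    ‖gaussExp (segmentMatrix B S t) 0 x‖ ≤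
      ‖gaussExp (B.map ofReal) 0 x‖ + ‖gaussExp S 0 x‖ := by
  simp only [norm_gaussExp, map_re_segmentMatrix, map_re_map_ofReal, add_mulVec, smul_mulVec,
    dotProduct_add, dotProduct_smul, smul_eq_mul]
  rcases le_total (x ⬝ᵥ B *ᵥ x) (x ⬝ᵥ S.map re *ᵥ x) with h | h
  · refine le_add_of_le_of_nonneg (Real.exp_le_exp.2 ?_) (Real.exp_nonneg _)
    nlinarith [mul_nonneg ht.1 (sub_nonneg.2 h)]
  · refine le_add_of_nonneg_of_le (Real.exp_nonneg _) (Real.exp_le_exp.2 ?_)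
    nlinarith [mul_nonneg (sub_nonneg.2 ht.2) (sub_nonneg.2 h)]

theorem continuousOn_gaussConst_segmentMatrix {B : Matrix ι ι ℝ} {S : Matrix ι ι ℂ}
    (hB : B.PosDef) (hre : (S.map re).PosDef) :
    ContinuousOn (fun t : ℝ => gaussConst (segmentMatrix B S t)) (Set.Icc 0 1) := by
  have hreB : ((B.map ofReal).map re).PosDef := by rwa [map_re_map_ofReal]
  refine continuousOn_of_dominated (fun t _ => (continuous_gaussExp _ _).aestronglyMeasurable)
    (fun t ht => .of_forall (norm_gaussExp_segmentMatrix_le B S ht))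
    ((integrable_gaussExp hreB 0).norm.add (integrable_gaussExp hre 0).norm)
    (.of_forall fun x => ?_)
  unfold gaussExp segmentMatrix dotProduct mulVec dotProduct
  simp only [Matrix.add_apply, Matrix.smul_apply, smul_eq_mul]
  fun_prop

variable [DecidableEq ι]

theorem exists_mulVec_eq_smul_of_mem_roots_charpoly {τ : Matrix ι ι ℂ} {z : ℂ}
    (hz : z ∈ τ.charpoly.roots) : ∃ v ≠ 0, τ *ᵥ v = z • v := by
  have hroot := (Polynomial.mem_roots'.1 hz).2
  rw [Polynomial.IsRoot, eval_charpoly] at hroot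
  obtain ⟨v, hv0, hv⟩ := exists_mulVec_eq_zero_iff.2 hroot
  rw [scalar_apply, ← smul_one_eq_diagonal, sub_mulVec, smul_mulVec, one_mulVec,
    sub_eq_zero] at hv
  exact ⟨v, hv0, hv.symm⟩

theorem re_pos_of_mul_eq_ofReal {z w : ℂ} {β : ℝ} (hw : 0 < w.re) (hβ : 0 < β)
    (h : z * w = β) : 0 < z.re := by
  have hz : z.re * (w.re ^ 2 + w.im ^ 2) = β * w.re := by
    have hre := congrArg re h
    have him := congrArg im h
    simp only [mul_re, mul_im, ofReal_re, ofReal_im] at hre him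
    linear_combination w.re * hre + w.im * him
  exact pos_of_mul_pos_left (hz ▸ mul_pos hβ hw) (by positivity)

-- For an eigenvector `v` of `S⁻¹B`, the eigenvalue is the quotient of `v* B v > 0` by `v* S v`.
theorem re_pos_of_mem_roots_charpoly {S τ : Matrix ι ι ℂ} {B : Matrix ι ι ℝ} (hS : S.IsSymm)
    (hre : (S.map re).PosDef) (hB : B.PosDef) (hτ : S * τ = B.map ofReal) {z : ℂ}
    (hz : z ∈ τ.charpoly.roots) : 0 < z.re := by
  obtain ⟨v, hv0, hv⟩ := exists_mulVec_eq_smul_of_mem_roots_charpoly hz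
  have hBpos := re_star_dotProduct_mulVec_pos (isSymm_map_ofReal hB)
    ((map_re_map_ofReal B).symm ▸ hB) hv0
  have hrel : z * (star v ⬝ᵥ S *ᵥ v) = star v ⬝ᵥ B.map ofReal *ᵥ v := by
    rw [← hτ, ← mulVec_mulVec, hv, mulVec_smul, dotProduct_smul, smul_eq_mul]
  rw [star_dotProduct_mulVec_of_isSymm (isSymm_map_ofReal hB)] at hBpos hrel
  simp only [map_ofReal_mulVec_cvec, cvec_dotProduct, ← ofReal_add, ofReal_re] at hBpos hrel
  exact re_pos_of_mul_eq_ofReal (re_star_dotProduct_mulVec_pos hS hre hv0) hBpos hrel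

theorem card_roots_charpoly (τ : Matrix ι ι ℂ) :
    Multiset.card τ.charpoly.roots = Fintype.card ι := by
  rw [← charpoly_natDegree_eq_dim τ]
  exact Polynomial.splits_iff_card_roots.1 (IsAlgClosed.splits τ.charpoly)

theorem det_smul_one_sub_eq_prod_roots (τ : Matrix ι ι ℂ) (t : ℂ) :
    (t • (1 : Matrix ι ι ℂ) - τ).det = (τ.charpoly.roots.map fun z => t - z).prod := by
  rw [smul_one_eq_diagonal, ← scalar_apply, ← eval_charpoly,
    (IsAlgClosed.splits τ.charpoly).eval_eq_prod_roots_of_monic τ.charpoly_monic]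

theorem det_smul_add_smul_one_eq_prod_roots (τ : Matrix ι ι ℂ) (s t : ℂ) :
    (s • τ + t • (1 : Matrix ι ι ℂ)).det = (τ.charpoly.roots.map fun z => s * z + t).prod := by
  rcases eq_or_ne s 0 with rfl | hs
  · simp [card_roots_charpoly]
  · have hmat : s • τ + t • (1 : Matrix ι ι ℂ) = (-s) • ((-t / s) • (1 : Matrix ι ι ℂ) - τ) := by
      rw [smul_sub, smul_smul, show -s * (-t / s) = t by field_simp, neg_smul, sub_neg_eq_add,
        add_comm]
    have hroots : (τ.charpoly.roots.map fun z => s * z + t) =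
        τ.charpoly.roots.map fun z => -s * (-t / s - z) :=
      Multiset.map_congr rfl fun z _ => by field_simp; ring
    rw [hmat, det_smul, det_smul_one_sub_eq_prod_roots, hroots, Multiset.prod_map_mul,
      Multiset.map_const', Multiset.prod_replicate, card_roots_charpoly]

/-- The square root of `det ((1 - t) τ + t)` which is continuous in `t` when the eigenvalues of
`τ` have positive real part: the product of the principal square roots of the eigenvalues. -/
def segmentSqrtDet (τ : Matrix ι ι ℂ) (t : ℝ) : ℂ :=
  (τ.charpoly.roots.map fun z => ((1 - t) * z + t : ℂ) ^ (1 / 2 : ℂ)).prod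

theorem segmentSqrtDet_zero (τ : Matrix ι ι ℂ) :
    segmentSqrtDet τ 0 = (τ.charpoly.roots.map fun z => z ^ (1 / 2 : ℂ)).prod := by
  simp [segmentSqrtDet]

theorem segmentSqrtDet_one (τ : Matrix ι ι ℂ) : segmentSqrtDet τ 1 = 1 := by
  simp [segmentSqrtDet]

theorem segmentSqrtDet_sq (τ : Matrix ι ι ℂ) (t : ℝ) :
    segmentSqrtDet τ t ^ 2 = ((1 - t : ℂ) • τ + (t : ℂ) • (1 : Matrix ι ι ℂ)).det := by
  rw [segmentSqrtDet, ← Multiset.prod_map_pow, det_smul_add_smul_one_eq_prod_roots]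
  simp only [cpow_half_sq]

theorem continuousOn_segmentSqrtDet {τ : Matrix ι ι ℂ} (hτ : ∀ z ∈ τ.charpoly.roots, 0 < z.re) :
    ContinuousOn (segmentSqrtDet τ) (Set.Icc 0 1) := by
  refine continuousOn_multiset_prod _ fun z hz => ?_
  refine ContinuousOn.cpow_const (by fun_prop) fun t ht => Or.inl ?_
  have hre : ((1 - t) * z + t : ℂ).re = (1 - t) * z.re + t := by simp
  have hpos := hτ z hz
  rw [hre]
  rcases ht.1.eq_or_lt with rfl | h
  · simpa using hpos
  · nlinarith [mul_nonneg (sub_nonneg.2 ht.2) hpos.le]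

theorem det_segmentMatrix {S τ : Matrix ι ι ℂ} {B : Matrix ι ι ℝ} (hτ : S * τ = B.map ofReal)
    (t : ℝ) : (segmentMatrix B S t).det = S.det * segmentSqrtDet τ t ^ 2 := by
  rw [segmentSqrtDet_sq, ← det_mul, segmentMatrix, Matrix.mul_add, mul_smul_comm, hτ,
    mul_smul_comm, Matrix.mul_one]

-- Both sides of the claim satisfy the same quadratic equation along the segment from `B` to `S`,
-- so by continuity it suffices to compare signs at the real end.
theorem gaussConst_eq {S τ : Matrix ι ι ℂ} {B : Matrix ι ι ℝ} (hS : S.IsSymm)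
    (hre : (S.map re).PosDef) (hB : B.PosDef) (hτ : S * τ = B.map ofReal) :
    gaussConst S = (((2 * Real.pi) ^ ((Fintype.card ι : ℝ) / 2) / √B.det : ℝ) : ℂ) *
      (τ.charpoly.roots.map fun z => z ^ (1 / 2 : ℂ)).prod := by
  set F : ℝ → ℂ := fun t => gaussConst (segmentMatrix B S t) * segmentSqrtDet τ t with hF
  have hsq : ∀ t ∈ Set.Icc (0 : ℝ) 1, S.det * F t ^ 2 = (2 * Real.pi) ^ Fintype.card ι :=
    fun t ht => by
      rw [← gaussConst_sq_mul_det (isSymm_segmentMatrix hB hS t)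
        (posDef_re_segmentMatrix hB hre ht),
        det_segmentMatrix hτ]
      ring
  have hdet : S.det ≠ 0 := fun h0 => by
    have := hsq 0 (Set.left_mem_Icc.2 zero_le_one)
    rw [h0, zero_mul] at this
    exact pow_ne_zero _ (by simp [Real.pi_ne_zero]) this.symm
  have hF1 : F 1 = gaussConst S := by simp only [hF, segmentMatrix_one, segmentSqrtDet_one, mul_one]
  have hF0 : F 1 ≠ 0 := hF1 ▸ gaussConst_ne_zero hS hre
  have hcont : ContinuousOn F (Set.Icc 0 1) :=
    (continuousOn_gaussConst_segmentMatrix hB hre).mul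
      (continuousOn_segmentSqrtDet fun z hz => re_pos_of_mem_roots_charpoly hS hre hB hτ hz)
  have hends : F 0 = F 1 :=
    isPreconnected_Icc.eq_of_sq_eq (g := fun _ => F 1) hcont continuousOn_const
      (fun t ht => mul_left_cancel₀ hdet
        ((hsq t ht).trans (hsq 1 (Set.right_mem_Icc.2 zero_le_one)).symm)) (fun _ => hF0)
      (Set.right_mem_Icc.2 zero_le_one) rfl (Set.left_mem_Icc.2 zero_le_one)
  rw [← hF1, ← hends, hF]
  simp only [segmentMatrix_zero, segmentSqrtDet_zero, gaussConst_ofReal hB]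

end SquareRootBranch

section IntegrationByParts

variable {ι : Type*} [Fintype ι]

theorem differentiable_dotProduct_cvec_add (w : ι → ℂ) (κ : ℂ) :
    Differentiable ℝ fun x : ι → ℝ => w ⬝ᵥ cvec x + κ := by
  unfold dotProduct cvec
  fun_prop

theorem fderiv_dotProduct_cvec_add (w : ι → ℂ) (κ : ℂ) (x v : ι → ℝ) :
    fderiv ℝ (fun x : ι → ℝ => w ⬝ᵥ cvec x + κ) x v = w ⬝ᵥ cvec v := by
  let ℓ : (ι → ℝ) →ₗ[ℝ] ℂ :=
    { toFun := fun x => w ⬝ᵥ cvec x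
      map_add' := fun x y => by rw [cvec_add, dotProduct_add]
      map_smul' := fun a x => by rw [cvec_smul, dotProduct_smul]; rfl }
  rw [fderiv_add_const]
  exact congrFun (congrArg _ (LinearMap.toContinuousLinearMap ℓ).fderiv) v

theorem integral_affine_mul_gaussExp_cvec {S : Matrix ι ι ℂ} (hS : S.IsSymm)
    (hre : (S.map re).PosDef) (b w : ι → ℂ) (κ : ℂ) (v : ι → ℝ) :
    ∫ x, (w ⬝ᵥ cvec x + κ) * (cvec v ⬝ᵥ S *ᵥ cvec x - I * (b ⬝ᵥ cvec v)) * gaussExp S b x =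
      (w ⬝ᵥ cvec v) * ∫ x, gaussExp S b x := by
  have hparts := integral_mul_fderiv_eq_neg_fderiv_mul_of_integrable (μ := volume) (𝕜 := ℂ)
    (f := fun x : ι → ℝ => w ⬝ᵥ cvec x + κ) (g := gaussExp S b) (v := v)
    (by simp only [fderiv_dotProduct_cvec_add]
        exact (integrable_gaussExp hre b).const_mul _)
    (by simp only [fderiv_gaussExp hS, ← mul_assoc]
        exact integrable_mul_gaussExp hre b (by fun_prop))
    (integrable_mul_gaussExp hre b (by fun_prop))
    (fun x _ => differentiable_dotProduct_cvec_add w κ x)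
    (fun x _ => differentiable_gaussExp S b x)
  simp only [fderiv_dotProduct_cvec_add, fderiv_gaussExp hS] at hparts
  rw [integral_const_mul] at hparts
  rw [← neg_inj, ← hparts, ← integral_neg]
  congr 1 with x
  ring

theorem integral_affine_mul_gaussExp {S : Matrix ι ι ℂ} (hS : S.IsSymm)
    (hre : (S.map re).PosDef) (b w u : ι → ℂ) (κ : ℂ) :
    ∫ x, (w ⬝ᵥ cvec x + κ) * (u ⬝ᵥ S *ᵥ cvec x - I * (b ⬝ᵥ u)) * gaussExp S b x =
      (w ⬝ᵥ u) * ∫ x, gaussExp S b x := by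
  obtain ⟨p, q, rfl⟩ : ∃ p q, u = cvec p + I • cvec q :=
    ⟨_, _, eq_cvec_re_add_I_smul_cvec_im u⟩
  have hint : ∀ v : ι → ℝ, Integrable fun x =>
      (w ⬝ᵥ cvec x + κ) * (cvec v ⬝ᵥ S *ᵥ cvec x - I * (b ⬝ᵥ cvec v)) * gaussExp S b x :=
    fun v => integrable_mul_gaussExp hre b (by fun_prop)
  calc _ = ∫ x,
          ((w ⬝ᵥ cvec x + κ) * (cvec p ⬝ᵥ S *ᵥ cvec x - I * (b ⬝ᵥ cvec p)) * gaussExp S b x +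
          I * ((w ⬝ᵥ cvec x + κ) * (cvec q ⬝ᵥ S *ᵥ cvec x - I * (b ⬝ᵥ cvec q)) *
            gaussExp S b x)) := by
        congr 1 with x
        simp only [add_dotProduct, dotProduct_add, smul_dotProduct, dotProduct_smul, smul_eq_mul]
        ring
    _ = (w ⬝ᵥ cvec p + I * (w ⬝ᵥ cvec q)) * ∫ x, gaussExp S b x := by
        rw [integral_add (hint p) ((hint q).const_mul I), integral_const_mul,
          integral_affine_mul_gaussExp_cvec hS hre, integral_affine_mul_gaussExp_cvec hS hre]
        ring
    _ = _ := by rw [dotProduct_add, dotProduct_smul, smul_eq_mul]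

end IntegrationByParts

section Symplectic

variable {n : ℕ}

section Omega

variable {𝕜 κ : Type} [CommRing 𝕜]

theorem omega_add_left (X Y Z : Phase 𝕜 n) : omega (X + Y) Z = omega X Z + omega Y Z := by
  simp only [omega, Prod.fst_add, Prod.snd_add, add_dotProduct, dotProduct_add]
  ring

theorem omega_smul_left (a : 𝕜) (X Y : Phase 𝕜 n) : omega (a • X) Y = a * omega X Y := by
  simp only [omega, Prod.smul_fst, Prod.smul_snd, smul_dotProduct, dotProduct_smul, smul_eq_mul]
  ring

theorem omega_swap (X Y : Phase 𝕜 n) : omega X Y = -omega Y X := (neg_sub _ _).symm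

theorem omega_add_right (X Y Z : Phase 𝕜 n) : omega X (Y + Z) = omega X Y + omega X Z := by
  rw [omega_swap, omega_add_left, neg_add, ← omega_swap, ← omega_swap]

theorem omega_smul_right (a : 𝕜) (X Y : Phase 𝕜 n) : omega X (a • Y) = a * omega X Y := by
  rw [omega_swap, omega_smul_left, ← mul_neg, ← omega_swap]

theorem omega_sum_smul_left (s : Finset κ) (a : κ → 𝕜) (X : κ → Phase 𝕜 n) (Y : Phase 𝕜 n) :
    omega (∑ i ∈ s, a i • X i) Y = ∑ i ∈ s, a i * omega (X i) Y := by
  simp only [← omega_smul_left]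
  exact map_sum (AddMonoidHom.mk' (omega · Y) fun X Z => omega_add_left X Z Y) _ s

theorem omega_sum_smul_right (s : Finset κ) (a : κ → 𝕜) (X : κ → Phase 𝕜 n) (Y : Phase 𝕜 n) :
    omega Y (∑ i ∈ s, a i • X i) = ∑ i ∈ s, a i * omega Y (X i) := by
  rw [omega_swap, omega_sum_smul_left, ← Finset.sum_neg_distrib]
  exact Finset.sum_congr rfl fun i _ => by rw [← mul_neg, ← omega_swap]

end Omega

theorem star_omega (X Y : Phase ℂ n) : star (omega X Y) = omega (star X) (star Y) := by
  simp [omega, dotProduct]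

theorem omega_toC (X Y : Phase ℝ n) : omega (toC X) (toC Y) = ((omega X Y : ℝ) : ℂ) := by
  simp [omega, toC, dotProduct]

theorem star_toC (X : Phase ℝ n) : star (toC X) = toC X := by
  ext <;> simp [toC]

theorem toC_add (X Y : Phase ℝ n) : toC (X + Y) = toC X + toC Y := by
  ext <;> simp [toC]

theorem toC_smul (a : ℝ) (X : Phase ℝ n) : toC (a • X) = (a : ℂ) • toC X := by
  ext <;> simp [toC]

theorem toC_zero : toC (0 : Phase ℝ n) = 0 := by
  ext <;> simp [toC]

theorem toC_sum {κ : Type} (s : Finset κ) (f : κ → Phase ℝ n) :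
    toC (∑ i ∈ s, f i) = ∑ i ∈ s, toC (f i) :=
  map_sum (AddMonoidHom.mk' toC toC_add) f s

theorem toC_eq_cvec (X : Phase ℝ n) : toC X = (cvec X.1, cvec X.2) := rfl

theorem eq_zero_of_cvec_add_I_smul_cvec_eq_zero {ι : Type} {x y : ι → ℝ}
    (h : cvec x + I • cvec y = 0) : x = 0 ∧ y = 0 := by
  have h' : ∀ j, (x j : ℂ) + I * y j = 0 := congrFun h
  exact ⟨funext fun j => by simpa using congrArg re (h' j),
    funext fun j => by simpa using congrArg im (h' j)⟩

theorem eq_zero_of_toC_add_I_smul_toC_eq_zero {X Y : Phase ℝ n} (h : toC X + I • toC Y = 0) :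
    X = 0 ∧ Y = 0 := by
  have h₁ := eq_zero_of_cvec_add_I_smul_cvec_eq_zero (congrArg Prod.fst h)
  have h₂ := eq_zero_of_cvec_add_I_smul_cvec_eq_zero (congrArg Prod.snd h)
  exact ⟨Prod.ext h₁.1 h₂.1, Prod.ext h₁.2 h₂.2⟩

end Symplectic

section Complexify

variable {n k : ℕ} {L : Submodule ℝ (Phase ℝ n)}

theorem toC_mem_complexify {X : Phase ℝ n} (hX : X ∈ L) : toC X ∈ complexify L :=
  Submodule.subset_span ⟨X, hX, rfl⟩

theorem mem_complexify_iff {Z : Phase ℂ n} :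
    Z ∈ complexify L ↔ ∃ X ∈ L, ∃ Y ∈ L, Z = toC X + I • toC Y := by
  constructor
  · intro h
    induction h using Submodule.span_induction with
    | mem x hx =>
      obtain ⟨X, hX, rfl⟩ := hx
      exact ⟨X, hX, 0, L.zero_mem, by rw [toC_zero, smul_zero, add_zero]⟩
    | zero => exact ⟨0, L.zero_mem, 0, L.zero_mem, by rw [toC_zero, smul_zero, add_zero]⟩
    | add x y _ _ hx hy =>
      obtain ⟨X, hX, Y, hY, rfl⟩ := hx
      obtain ⟨X', hX', Y', hY', rfl⟩ := hy
      refine ⟨X + X', L.add_mem hX hX', Y + Y', L.add_mem hY hY', ?_⟩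
      rw [toC_add, toC_add]
      module
    | smul a x _ hx =>
      obtain ⟨X, hX, Y, hY, rfl⟩ := hx
      refine ⟨a.re • X + (-a.im) • Y, L.add_mem (L.smul_mem _ hX) (L.smul_mem _ hY),
        a.re • Y + a.im • X, L.add_mem (L.smul_mem _ hY) (L.smul_mem _ hX), ?_⟩
      simp only [toC_add, toC_smul]
      conv_lhs => rw [← re_add_im a]
      push_cast
      linear_combination (norm := module) ((a.im : ℂ) * I_mul_I) • toC Y
  · rintro ⟨X, hX, Y, hY, rfl⟩
    exact Submodule.add_mem _ (toC_mem_complexify hX)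
      (Submodule.smul_mem _ _ (toC_mem_complexify hY))

theorem star_mem_complexify {Z : Phase ℂ n} (hZ : Z ∈ complexify L) : star Z ∈ complexify L := by
  obtain ⟨X, hX, Y, hY, rfl⟩ := mem_complexify_iff.1 hZ
  rw [star_add, star_smul, star_toC, star_toC]
  exact Submodule.add_mem _ (toC_mem_complexify hX) (Submodule.smul_mem _ _ (toC_mem_complexify hY))

theorem complexify_le_skewOrth (hiso : ∀ X ∈ L, ∀ Y ∈ L, omega X Y = 0) :
    complexify L ≤ skewOrth (complexify L) := by
  intro Z hZ Z' hZ'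
  obtain ⟨X, hX, Y, hY, rfl⟩ := mem_complexify_iff.1 hZ
  obtain ⟨X', hX', Y', hY', rfl⟩ := mem_complexify_iff.1 hZ'
  simp [omega_add_left, omega_add_right, omega_smul_left, omega_smul_right, omega_toC,
    hiso _ hX _ hX', hiso _ hX _ hY', hiso _ hY _ hX', hiso _ hY _ hY']

theorem eq_zero_of_mem_complexify_of_snd_eq_zero
    (hproj : Set.InjOn Prod.snd (L : Set (Phase ℝ n))) {Z : Phase ℂ n} (hZ : Z ∈ complexify L)
    (h : Z.2 = 0) : Z = 0 := by
  obtain ⟨X, hX, Y, hY, rfl⟩ := mem_complexify_iff.1 hZ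
  obtain ⟨hX₂, hY₂⟩ := eq_zero_of_cvec_add_I_smul_cvec_eq_zero (x := X.2) (y := Y.2) h
  rw [hproj hX L.zero_mem hX₂, hproj hY L.zero_mem hY₂, toC_zero, smul_zero, add_zero]

theorem coe_sum_smul_inC (e : Module.Basis (Fin k) ℝ L) (z : Fin k → ℂ) :
    ((∑ a, z a • inC L (e a) : complexify L) : Phase ℂ n) = ∑ a, z a • toC (e a) :=
  Submodule.coe_sum _ _ _

theorem toC_equivFun_symm (e : Module.Basis (Fin k) ℝ L) (x : Fin k → ℝ) :
    toC (e.equivFun.symm x : Phase ℝ n) = ∑ a, cvec x a • toC (e a) := by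
  rw [Module.Basis.equivFun_symm_apply, Submodule.coe_sum, toC_sum]
  exact Finset.sum_congr rfl fun a _ => toC_smul _ _

theorem sum_smul_toC_basis (e : Module.Basis (Fin k) ℝ L) (x y : Fin k → ℝ) :
    ∑ a, (cvec x + I • cvec y) a • toC (e a : Phase ℝ n) =
      toC (e.equivFun.symm x : Phase ℝ n) + I • toC (e.equivFun.symm y : Phase ℝ n) := by
  simp only [toC_equivFun_symm, Pi.add_apply, Pi.smul_apply, add_smul, Finset.sum_add_distrib,
    Finset.smul_sum, smul_assoc]

theorem linearIndependent_inC (e : Module.Basis (Fin k) ℝ L) :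
    LinearIndependent ℂ fun a => inC L (e a) := by
  rw [Fintype.linearIndependent_iff]
  intro z hz
  have h := coe_sum_smul_inC e z
  rw [hz, eq_cvec_re_add_I_smul_cvec_im z, sum_smul_toC_basis] at h
  obtain ⟨hre, him⟩ := eq_zero_of_toC_add_I_smul_toC_eq_zero h.symm
  rw [Submodule.coe_eq_zero, LinearEquiv.map_eq_zero_iff] at hre him
  exact fun a => Complex.ext (congrFun hre a) (congrFun him a)

theorem top_le_span_range_inC (e : Module.Basis (Fin k) ℝ L) :
    ⊤ ≤ Submodule.span ℂ (Set.range fun a => inC L (e a)) := by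
  rintro ⟨Z, hZ⟩ -
  obtain ⟨X, hX, Y, hY, rfl⟩ := mem_complexify_iff.1 hZ
  rw [Submodule.mem_span_range_iff_exists_fun]
  refine ⟨cvec (e.equivFun ⟨X, hX⟩) + I • cvec (e.equivFun ⟨Y, hY⟩), Subtype.ext ?_⟩
  rw [coe_sum_smul_inC, sum_smul_toC_basis, LinearEquiv.symm_apply_apply,
    LinearEquiv.symm_apply_apply]

/-- A real basis of `L`, as a complex basis of `L^ℂ`. -/
def complexBasis (e : Module.Basis (Fin k) ℝ L) : Module.Basis (Fin k) ℂ (complexify L) :=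
  Module.Basis.mk (linearIndependent_inC e) (top_le_span_range_inC e)

theorem complexBasis_apply (e : Module.Basis (Fin k) ℝ L) (a : Fin k) :
    complexBasis e a = inC L (e a) := Module.Basis.mk_apply _ _ a

theorem sum_repr_complexBasis (e : Module.Basis (Fin k) ℝ L) (Z : complexify L) :
    ∑ a, (complexBasis e).repr Z a • toC (e a : Phase ℝ n) = Z := by
  conv_rhs => rw [← (complexBasis e).sum_repr Z]
  simp only [complexBasis_apply, coe_sum_smul_inC]

end Complexify

section HermForm

variable {n : ℕ} {κ : Type} [Fintype κ]

/-- The Hermitian form `(1/i) ω(Y, Y'*)`; it is positive definite on the germ of a Gaussian. -/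
def hermForm (Y Y' : Phase ℂ n) : ℂ := 1 / I * omega Y (star Y')

theorem star_hermForm (Y Y' : Phase ℂ n) : star (hermForm Y Y') = hermForm Y' Y := by
  rw [hermForm, hermForm, star_mul', star_omega, star_star, omega_swap]
  simp

theorem hermForm_star_star (Y Y' : Phase ℂ n) :
    hermForm (star Y) (star Y') = -star (hermForm Y Y') := by
  rw [hermForm, hermForm, star_mul', star_omega]
  simp

theorem hermForm_add_left (X Y Z : Phase ℂ n) :
    hermForm (X + Y) Z = hermForm X Z + hermForm Y Z := by
  rw [hermForm, omega_add_left, mul_add, hermForm, hermForm]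

theorem hermForm_add_right (X Y Z : Phase ℂ n) :
    hermForm X (Y + Z) = hermForm X Y + hermForm X Z := by
  rw [hermForm, star_add, omega_add_right, mul_add, hermForm, hermForm]

theorem hermForm_sum_smul (X : κ → Phase ℂ n) (z w : κ → ℂ) :
    hermForm (∑ a, z a • X a) (∑ a, w a • X a) =
      z ⬝ᵥ (Matrix.of fun a b => hermForm (X a) (X b)) *ᵥ star w := by
  simp only [hermForm, star_sum, star_smul, omega_sum_smul_left, omega_sum_smul_right, dotProduct,
    mulVec, of_apply, Finset.mul_sum, Pi.star_apply]
  rw [Finset.sum_comm]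
  exact Finset.sum_congr rfl fun a _ => Finset.sum_congr rfl fun b _ => by ring

theorem hermForm_eq_zero_of_mem_skewOrth {L : Submodule ℝ (Phase ℝ n)} {Y Z : Phase ℂ n}
    (hY : Y ∈ skewOrth (complexify L)) (hZ : Z ∈ complexify L) : hermForm Y Z = 0 := by
  rw [hermForm, hY _ (star_mem_complexify hZ), mul_zero]

end HermForm

section Graph

variable {n : ℕ} {A : Matrix (Fin n) (Fin n) ℂ}

/-- The map `v ↦ (A v, v)` parametrizing the graph of `A` over the coordinate plane. -/
def graphMap (A : Matrix (Fin n) (Fin n) ℂ) : (Fin n → ℂ) →ₗ[ℂ] Phase ℂ n :=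
  A.mulVecLin.prod LinearMap.id

@[simp] theorem graphMap_fst (v : Fin n → ℂ) : (graphMap A v).1 = A *ᵥ v := rfl

@[simp] theorem graphMap_snd (v : Fin n → ℂ) : (graphMap A v).2 = v := rfl

/-- The Lagrangian plane `{(A Q, Q)}`, which is the germ of the Gaussian with matrix `A`. -/
def graph (A : Matrix (Fin n) (Fin n) ℂ) : Submodule ℂ (Phase ℂ n) := LinearMap.range (graphMap A)

theorem graphMap_mem_graph (v : Fin n → ℂ) : graphMap A v ∈ graph A := ⟨v, rfl⟩

theorem mem_graph_iff {Y : Phase ℂ n} : Y ∈ graph A ↔ Y.1 = A *ᵥ Y.2 :=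
  ⟨fun ⟨_, hv⟩ => hv ▸ rfl, fun h => ⟨Y.2, Prod.ext h.symm rfl⟩⟩

theorem graphMap_snd_of_mem {Y : Phase ℂ n} (hY : Y ∈ graph A) : graphMap A Y.2 = Y :=
  Prod.ext (mem_graph_iff.1 hY).symm rfl

theorem finrank_graph (A : Matrix (Fin n) (Fin n) ℂ) : Module.finrank ℂ (graph A) = n := by
  rw [graph, LinearMap.finrank_range_of_inj fun v w h => congrArg Prod.snd h,
    Module.finrank_fin_fun]

theorem omega_graphMap_left (hA : A.IsSymm) (v : Fin n → ℂ) (Z : Phase ℂ n) :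
    omega (graphMap A v) Z = -((Z.1 - A *ᵥ Z.2) ⬝ᵥ v) := by
  rw [omega, graphMap_fst, graphMap_snd, sub_dotProduct, dotProduct_comm (A *ᵥ v),
    dotProduct_comm (A *ᵥ Z.2), dotProduct_mulVec_comm hA]
  ring

theorem omega_eq_zero_of_mem_graph (hA : A.IsSymm) {Y Y' : Phase ℂ n} (hY : Y ∈ graph A)
    (hY' : Y' ∈ graph A) : omega Y Y' = 0 := by
  rw [← graphMap_snd_of_mem hY, omega_graphMap_left hA, mem_graph_iff.1 hY', sub_self,
    zero_dotProduct, neg_zero]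

/-- The matrix `2 Im A = -i (A - Ā)`, with complex entries: the Gram matrix of `hermForm` on the
graph of `A`, and the matrix of the quadratic exponent of `|ψ_A|²`. -/
def normMatrix (A : Matrix (Fin n) (Fin n) ℂ) : Matrix (Fin n) (Fin n) ℂ := -I • (A - A.map star)

theorem normMatrix_eq (A : Matrix (Fin n) (Fin n) ℂ) :
    normMatrix A = ((2 : ℝ) • A.map im).map ofReal := by
  ext i j
  calc -I * (A i j - star (A i j)) = -I * (((2 * (A i j).im : ℝ) : ℂ) * I) := by
        rw [← sub_conj]
        rfl
    _ = ((2 * (A i j).im : ℝ) : ℂ) := by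
        rw [mul_left_comm, neg_mul, I_mul_I, neg_neg, mul_one]

theorem sub_mulVec_map_star (v : Fin n → ℂ) :
    A *ᵥ v - A.map star *ᵥ v = I • (normMatrix A *ᵥ v) := by
  rw [← sub_mulVec, normMatrix, smul_mulVec, smul_smul, mul_neg, I_mul_I, neg_neg, one_smul]

theorem isSymm_normMatrix (hIm : (A.map im).PosDef) : (normMatrix A).IsSymm := by
  rw [normMatrix_eq]
  exact isSymm_map_ofReal (hIm.smul two_pos)

theorem posDef_normMatrix (hIm : (A.map im).PosDef) : ((normMatrix A).map re).PosDef := by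
  rw [normMatrix_eq, map_re_map_ofReal]
  exact hIm.smul two_pos

theorem isUnit_det_normMatrix (hIm : (A.map im).PosDef) : IsUnit (normMatrix A).det := by
  rw [normMatrix_eq, det_map_ofReal, isUnit_iff_ne_zero, ofReal_ne_zero]
  exact (hIm.smul two_pos).det_pos.ne'

theorem star_mulVec_map_star (A : Matrix (Fin n) (Fin n) ℂ) (v : Fin n → ℂ) :
    star (A *ᵥ v) = A.map star *ᵥ star v := by
  ext
  simp [mulVec, dotProduct]

theorem star_map_star_mulVec (A : Matrix (Fin n) (Fin n) ℂ) (v : Fin n → ℂ) :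
    star (A.map star *ᵥ v) = A *ᵥ star v := by
  ext
  simp [mulVec, dotProduct]

theorem hermForm_graphMap (hA : A.IsSymm) (v w : Fin n → ℂ) :
    hermForm (graphMap A v) (graphMap A w) = v ⬝ᵥ normMatrix A *ᵥ star w := by
  have hN : (star (graphMap A w)).1 - A *ᵥ (star (graphMap A w)).2 =
      -(I • (normMatrix A *ᵥ star w)) := by
    rw [← sub_mulVec_map_star, neg_sub, ← star_mulVec_map_star]
    rfl
  rw [hermForm, omega_graphMap_left hA, hN, neg_dotProduct, neg_neg, smul_dotProduct, smul_eq_mul,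
    ← mul_assoc, one_div_mul_cancel I_ne_zero, one_mul, dotProduct_comm]

theorem re_hermForm_self_pos (hA : A.IsSymm) (hIm : (A.map im).PosDef) {Y : Phase ℂ n}
    (hY : Y ∈ graph A) (h0 : Y ≠ 0) : 0 < (hermForm Y Y).re := by
  have hv : Y.2 ≠ 0 := fun hv => h0 (by rw [← graphMap_snd_of_mem hY, hv, map_zero])
  rw [← graphMap_snd_of_mem hY, hermForm_graphMap hA,
    dotProduct_mulVec_comm (isSymm_normMatrix hIm)]
  exact re_star_dotProduct_mulVec_pos (isSymm_normMatrix hIm) (posDef_normMatrix hIm) hv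

theorem eq_zero_of_hermForm_self_eq_zero (hA : A.IsSymm) (hIm : (A.map im).PosDef) {Y : Phase ℂ n}
    (hY : Y ∈ graph A) (h : hermForm Y Y = 0) : Y = 0 := by
  by_contra h0
  have hpos := re_hermForm_self_pos hA hIm hY h0
  rw [h, zero_re] at hpos
  exact lt_irrefl _ hpos

end Graph

section GermProj

variable {n : ℕ} {A : Matrix (Fin n) (Fin n) ℂ}

/-- The coordinates `Q = (A - Ā)⁻¹ (Z.1 - Ā Z.2)` of the component `(A Q, Q)` of `Z` in the
decomposition of `ℂ²ⁿ` into the graphs of `A` and of `Ā`. -/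
def germCoord (A : Matrix (Fin n) (Fin n) ℂ) : Phase ℂ n →ₗ[ℂ] (Fin n → ℂ) :=
  -I • ((normMatrix A)⁻¹.mulVecLin ∘ₗ
    (LinearMap.fst ℂ _ _ - (A.map star).mulVecLin ∘ₗ LinearMap.snd ℂ _ _))

theorem germCoord_apply (Z : Phase ℂ n) :
    germCoord A Z = -I • ((normMatrix A)⁻¹ *ᵥ (Z.1 - A.map star *ᵥ Z.2)) := rfl

/-- The projection of `ℂ²ⁿ` to the graph of `A` along its complex conjugate. -/
def germProj (A : Matrix (Fin n) (Fin n) ℂ) : Phase ℂ n →ₗ[ℂ] Phase ℂ n :=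
  graphMap A ∘ₗ germCoord A

theorem germProj_apply (Z : Phase ℂ n) : germProj A Z = graphMap A (germCoord A Z) := rfl

theorem germProj_mem_graph (Z : Phase ℂ n) : germProj A Z ∈ graph A := graphMap_mem_graph _

theorem normMatrix_mulVec_germCoord (hIm : (A.map im).PosDef) (Z : Phase ℂ n) :
    I • (normMatrix A *ᵥ germCoord A Z) = Z.1 - A.map star *ᵥ Z.2 := by
  rw [germCoord_apply, mulVec_smul, mulVec_mulVec, mul_nonsing_inv _ (isUnit_det_normMatrix hIm),
    one_mulVec, smul_smul, mul_neg, I_mul_I, neg_neg, one_smul]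

theorem normMatrix_mulVec_star_germCoord (hIm : (A.map im).PosDef) (Z : Phase ℂ n) :
    I • (normMatrix A *ᵥ star (germCoord A (star Z))) = -(Z.1 - A *ᵥ Z.2) := by
  have h := congrArg star (normMatrix_mulVec_germCoord hIm (star Z))
  rw [← sub_mulVec_map_star, star_sub, star_sub, star_mulVec_map_star, star_map_star_mulVec,
    star_map_star_mulVec, Prod.fst_star, Prod.snd_star, star_star, star_star] at h
  rw [← sub_mulVec_map_star, ← h, neg_sub]

theorem germCoord_add_star (hIm : (A.map im).PosDef) (Z : Phase ℂ n) :
    germCoord A Z + star (germCoord A (star Z)) = Z.2 := by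
  refine (mulVec_injective_iff_isUnit.2 ((isUnit_iff_isUnit_det _).2 (isUnit_det_normMatrix hIm)))
    (smul_right_injective _ I_ne_zero ?_)
  change I • (normMatrix A *ᵥ _) = I • (normMatrix A *ᵥ _)
  rw [mulVec_add, smul_add, normMatrix_mulVec_germCoord hIm, normMatrix_mulVec_star_germCoord hIm,
    ← sub_mulVec_map_star]
  abel

theorem germProj_add_star (hIm : (A.map im).PosDef) (Z : Phase ℂ n) :
    germProj A Z + star (germProj A (star Z)) = Z := by
  have hQ := germCoord_add_star hIm Z
  refine Prod.ext ?_ hQ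
  calc A *ᵥ germCoord A Z + star (A *ᵥ germCoord A (star Z))
      = (A *ᵥ germCoord A Z - A.map star *ᵥ germCoord A Z) +
          A.map star *ᵥ (germCoord A Z + star (germCoord A (star Z))) := by
        rw [star_mulVec_map_star, mulVec_add]
        abel
    _ = Z.1 := by
        rw [sub_mulVec_map_star, normMatrix_mulVec_germCoord hIm, hQ, sub_add_cancel]

theorem germProj_add_star_toC (hIm : (A.map im).PosDef) (X : Phase ℝ n) :
    germProj A (toC X) + star (germProj A (toC X)) = toC X := by
  conv_rhs => rw [← germProj_add_star hIm (toC X), star_toC]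

theorem germProj_eq_self (hIm : (A.map im).PosDef) {Y : Phase ℂ n} (hY : Y ∈ graph A) :
    germProj A Y = Y := by
  conv_rhs => rw [← graphMap_snd_of_mem hY]
  rw [germProj_apply, germCoord_apply, mem_graph_iff.1 hY, sub_mulVec_map_star, mulVec_smul,
    mulVec_mulVec, nonsing_inv_mul _ (isUnit_det_normMatrix hIm), one_mulVec, smul_smul, neg_mul,
    I_mul_I, neg_neg, one_smul]

theorem germProj_star_eq_zero {Y : Phase ℂ n} (hY : Y ∈ graph A) : germProj A (star Y) = 0 := by
  have h : (star Y).1 - A.map star *ᵥ (star Y).2 = 0 := by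
    rw [Prod.fst_star, Prod.snd_star, ← star_mulVec_map_star, ← mem_graph_iff.1 hY, sub_self]
  rw [germProj_apply, germCoord_apply, h, mulVec_zero, smul_zero, map_zero]

theorem hermForm_germProj_right (hA : A.IsSymm) (hIm : (A.map im).PosDef) {Y : Phase ℂ n}
    (hY : Y ∈ graph A) (Z : Phase ℂ n) : hermForm Y (germProj A Z) = hermForm Y Z := by
  have h : hermForm Y (star (germProj A (star Z))) = 0 := by
    rw [hermForm, star_star, omega_eq_zero_of_mem_graph hA hY (germProj_mem_graph _), mul_zero]
  conv_rhs => rw [← germProj_add_star hIm Z, hermForm_add_right, h, add_zero]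

theorem hermForm_eq_sub (hA : A.IsSymm) (hIm : (A.map im).PosDef) (Z Z' : Phase ℂ n) :
    hermForm Z Z' = hermForm (germProj A Z) (germProj A Z') -
      star (hermForm (germProj A (star Z)) (germProj A (star Z'))) := by
  have hcross : ∀ Y Y' : Phase ℂ n,
      hermForm (star (germProj A Y)) (germProj A Y') = 0 := fun Y Y' => by
    rw [hermForm, ← star_omega, omega_eq_zero_of_mem_graph hA (germProj_mem_graph _)
      (germProj_mem_graph _), star_zero, mul_zero]
  have hcross' : ∀ Y Y' : Phase ℂ n,
      hermForm (germProj A Y') (star (germProj A Y)) = 0 := fun Y Y' => by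
    rw [← star_hermForm, hcross, star_zero]
  conv_lhs => rw [← germProj_add_star hIm Z, ← germProj_add_star hIm Z']
  rw [hermForm_add_left, hermForm_add_right, hermForm_add_right, hcross, hcross',
    hermForm_star_star]
  ring

end GermProj

section GermStructure

variable {n : ℕ} {A : Matrix (Fin n) (Fin n) ℂ} {L : Submodule ℝ (Phase ℝ n)}
  {ψ : (Fin n → ℝ) → ℂ} {Y W : Phase ℂ n}

theorem finrank_le_add_finrank_inf_skewOrth (S R : Submodule ℂ (Phase ℂ n)) :
    Module.finrank ℂ S ≤ Module.finrank ℂ R + Module.finrank ℂ ↥(S ⊓ skewOrth R) := by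
  let B : S →ₗ[ℂ] Module.Dual ℂ R := LinearMap.mk₂ ℂ (fun Y Z => omega (Y : Phase ℂ n) Z)
    (fun _ _ _ => omega_add_left _ _ _) (fun _ _ _ => omega_smul_left _ _ _)
    (fun _ _ _ => omega_add_right _ _ _) (fun _ _ _ => omega_smul_right _ _ _)
  have hker : (LinearMap.ker B).map S.subtype ≤ S ⊓ skewOrth R := by
    rintro _ ⟨Y, hY, rfl⟩
    exact ⟨Y.2, fun Z hZ => LinearMap.congr_fun hY ⟨Z, hZ⟩⟩
  have hrange := (LinearMap.range B).finrank_le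
  have hker_le := Submodule.finrank_mono hker
  rw [Subspace.dual_finrank_eq] at hrange
  rw [Submodule.finrank_map_subtype_eq] at hker_le
  rw [← B.finrank_range_add_finrank_ker]
  exact add_le_add hrange hker_le

theorem hermForm_eq_zero_iff {Y Y' : Phase ℂ n} : hermForm Y Y' = 0 ↔ omega Y (star Y') = 0 := by
  rw [hermForm, mul_eq_zero_iff_left (one_div_ne_zero I_ne_zero)]

theorem hermForm_eq_zero_of_mem_complexify (hiso : ∀ X ∈ L, ∀ Y ∈ L, omega X Y = 0)
    {Z Z' : Phase ℂ n} (hZ : Z ∈ complexify L) (hZ' : Z' ∈ complexify L) : hermForm Z Z' = 0 :=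
  hermForm_eq_zero_of_mem_skewOrth (complexify_le_skewOrth hiso hZ) hZ'

theorem eq_zero_of_mem_complexify_of_germProj_eq_zero (hA : A.IsSymm) (hIm : (A.map im).PosDef)
    (hiso : ∀ X ∈ L, ∀ Y ∈ L, omega X Y = 0) {Z : Phase ℂ n} (hZ : Z ∈ complexify L)
    (h : germProj A Z = 0) : Z = 0 := by
  have h₀ : hermForm (germProj A Z) (germProj A Z) = 0 := by simp [h, hermForm, omega]
  have hform := hermForm_eq_sub hA hIm Z Z
  rw [hermForm_eq_zero_of_mem_complexify hiso hZ hZ, h₀, zero_sub, eq_comm, neg_eq_zero,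
    star_eq_zero] at hform
  rw [← germProj_add_star hIm Z, h,
    eq_zero_of_hermForm_self_eq_zero hA hIm (germProj_mem_graph _) hform, star_zero, add_zero]

theorem hermForm_germProj_eq_zero (hA : A.IsSymm) (hIm : (A.map im).PosDef)
    (hψ : sGerm ψ = graph A) (hW : W ∈ rPerp L ψ) {Z : Phase ℂ n} (hZ : Z ∈ complexify L) :
    hermForm W (germProj A Z) = 0 := by
  rw [hermForm_germProj_right hA hIm (hψ.le hW.1), hermForm_eq_zero_of_mem_skewOrth hW.2 hZ]

theorem disjoint_complexify_rPerp (hA : A.IsSymm) (hIm : (A.map im).PosDef)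
    (hiso : ∀ X ∈ L, ∀ Y ∈ L, omega X Y = 0) (hψ : sGerm ψ = graph A) :
    Disjoint (complexify L) (rPerp L ψ) :=
  Submodule.disjoint_def.2 fun _ hZ hW => eq_zero_of_hermForm_self_eq_zero hA hIm (hψ.le hW.1)
    (hermForm_eq_zero_of_mem_complexify hiso hZ hZ)

theorem disjoint_map_germProj_rPerp (hA : A.IsSymm) (hIm : (A.map im).PosDef)
    (hψ : sGerm ψ = graph A) : Disjoint ((complexify L).map (germProj A)) (rPerp L ψ) := by
  refine Submodule.disjoint_def.2 ?_
  rintro _ ⟨Z, hZ, rfl⟩ hW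
  exact eq_zero_of_hermForm_self_eq_zero hA hIm (germProj_mem_graph Z)
    (hermForm_germProj_eq_zero hA hIm hψ hW hZ)

theorem le_finrank_complexify_add_finrank_rPerp (hψ : sGerm ψ = graph A) :
    n ≤ Module.finrank ℂ (complexify L) + Module.finrank ℂ (rPerp L ψ) := by
  conv_lhs => rw [← finrank_graph A, ← hψ]
  exact finrank_le_add_finrank_inf_skewOrth _ _

theorem map_germProj_sup_rPerp (hA : A.IsSymm) (hIm : (A.map im).PosDef)
    (hiso : ∀ X ∈ L, ∀ Y ∈ L, omega X Y = 0) (hψ : sGerm ψ = graph A) :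
    (complexify L).map (germProj A) ⊔ rPerp L ψ = sGerm ψ := by
  have hmap : (complexify L).map (germProj A) ≤ sGerm ψ := by
    rintro _ ⟨Z, -, rfl⟩
    exact hψ.ge (germProj_mem_graph Z)
  have hinj : LinearMap.ker ((germProj A).domRestrict (complexify L)) = ⊥ :=
    LinearMap.ker_eq_bot'.2 fun Z hZ => Subtype.ext
      (eq_zero_of_mem_complexify_of_germProj_eq_zero hA hIm hiso Z.2 hZ)
  have hfin : Module.finrank ℂ ((complexify L).map (germProj A)) =
      Module.finrank ℂ (complexify L) := by
    rw [← LinearMap.range_domRestrict, LinearMap.finrank_range_of_inj (LinearMap.ker_eq_bot.1 hinj)]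
  refine Submodule.eq_of_le_of_finrank_le (sup_le hmap inf_le_left) ?_
  have hsum := Submodule.finrank_sup_add_finrank_inf_eq ((complexify L).map (germProj A))
    (rPerp L ψ)
  rw [(disjoint_map_germProj_rPerp hA hIm hψ).eq_bot, finrank_bot, add_zero, hfin] at hsum
  rw [hsum, hψ, finrank_graph]
  exact le_finrank_complexify_add_finrank_rPerp hψ

theorem map_germProj_complexify (hA : A.IsSymm) (hIm : (A.map im).PosDef)
    (hiso : ∀ X ∈ L, ∀ Y ∈ L, omega X Y = 0) (hψ : sGerm ψ = graph A) :
    (complexify L).map (germProj A) = rMinus L ψ := by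
  have hle : (complexify L).map (germProj A) ≤ rMinus L ψ := by
    rintro _ ⟨Z, hZ, rfl⟩
    refine ⟨hψ.ge (germProj_mem_graph Z), fun W hW => hermForm_eq_zero_iff.1 ?_⟩
    rw [← star_hermForm, hermForm_germProj_eq_zero hA hIm hψ hW hZ, star_zero]
  refine le_antisymm hle fun Y hY => ?_
  obtain ⟨Y', hY', W, hW, rfl⟩ :=
    Submodule.mem_sup.1 ((map_germProj_sup_rPerp hA hIm hiso hψ).ge (rMinus_le L ψ hY))
  have hWm : W ∈ rMinus L ψ := by simpa using Submodule.sub_mem _ hY (hle hY')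
  rw [eq_zero_of_hermForm_self_eq_zero hA hIm (hψ.le hW.1)
    (hermForm_eq_zero_iff.2 (hWm.2 W hW)), add_zero]
  exact hY'

theorem projQInv_eq {R : Submodule ℂ (Phase ℂ n)} (h : Function.Bijective (projQ R)) {Y : R}
    {v : Fin n → ℂ} (hY : (Y : Phase ℂ n).2 = v) : projQInv h v = Y := by
  subst hY
  exact (LinearEquiv.ofBijective (projQ R) h).symm_apply_apply Y

theorem projQInv_snd {R : Submodule ℂ (Phase ℂ n)} (h : Function.Bijective (projQ R))
    (v : Fin n → ℂ) : (projQInv h v : Phase ℂ n).2 = v :=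
  (LinearEquiv.ofBijective (projQ R) h).apply_symm_apply v

theorem bijective_projQ_sGerm (hψ : sGerm ψ = graph A) :
    Function.Bijective (projQ (sGerm ψ)) := by
  rw [hψ]
  refine ⟨fun Y Y' h => Subtype.ext ?_, fun v => ⟨⟨_, graphMap_mem_graph v⟩, rfl⟩⟩
  rw [← graphMap_snd_of_mem Y.2, ← graphMap_snd_of_mem Y'.2]
  exact congrArg (graphMap A) h

theorem injective_projQ_sup (hA : A.IsSymm) (hIm : (A.map im).PosDef)
    (hiso : ∀ X ∈ L, ∀ Y ∈ L, omega X Y = 0)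
    (hproj : Set.InjOn Prod.snd (L : Set (Phase ℝ n))) (hψ : sGerm ψ = graph A) :
    Function.Injective (projQ (complexify L ⊔ rPerp L ψ)) := by
  rw [← LinearMap.ker_eq_bot, LinearMap.ker_eq_bot']
  rintro ⟨_, hY⟩ hY₂
  obtain ⟨Z, hZ, W, hW, rfl⟩ := Submodule.mem_sup.1 hY
  replace hY₂ : (Z + W).2 = 0 := hY₂
  have hWZ := hermForm_eq_zero_of_mem_skewOrth hW.2 hZ
  have hWW : hermForm W W = 0 := calc
    hermForm W W = hermForm (Z + W) (Z + W) := by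
      rw [hermForm_add_left, hermForm_add_right, hermForm_add_right, hWZ, ← star_hermForm W Z,
        hWZ, hermForm_eq_zero_of_mem_complexify hiso hZ hZ, star_zero, zero_add, zero_add,
        zero_add]
    _ = 0 := by
      rw [hermForm, omega, Prod.snd_star, hY₂, star_zero, dotProduct_zero, dotProduct_zero,
        sub_zero, mul_zero]
  have hW0 := eq_zero_of_hermForm_self_eq_zero hA hIm (hψ.le hW.1) hWW
  have hZ0 : Z = 0 := eq_zero_of_mem_complexify_of_snd_eq_zero hproj hZ (by simpa [hW0] using hY₂)
  exact Subtype.ext (show Z + W = 0 by rw [hZ0, hW0, add_zero])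

theorem bijective_projQ_sup (hA : A.IsSymm) (hIm : (A.map im).PosDef)
    (hiso : ∀ X ∈ L, ∀ Y ∈ L, omega X Y = 0)
    (hproj : Set.InjOn Prod.snd (L : Set (Phase ℝ n))) (hψ : sGerm ψ = graph A) :
    Function.Bijective (projQ (complexify L ⊔ rPerp L ψ)) := by
  have hinj := injective_projQ_sup hA hIm hiso hproj hψ
  refine ⟨hinj, LinearMap.range_eq_top.1 (Submodule.eq_top_of_finrank_eq (le_antisymm
    (Submodule.finrank_le _) ?_))⟩
  have hsum := Submodule.finrank_sup_add_finrank_inf_eq (complexify L) (rPerp L ψ)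
  rw [(disjoint_complexify_rPerp hA hIm hiso hψ).eq_bot, finrank_bot, add_zero] at hsum
  rw [LinearMap.finrank_range_of_inj hinj, hsum, Module.finrank_fin_fun]
  exact le_finrank_complexify_add_finrank_rPerp hψ

end GermStructure

section GermOperators

variable {n : ℕ} {A : Matrix (Fin n) (Fin n) ℂ} {L : Submodule ℝ (Phase ℝ n)}
  {ψ : (Fin n → ℝ) → ℂ}

section PMinus

variable {Pm : complexify L →ₗ[ℂ] rMinus L ψ}

theorem exists_isPMinus (hA : A.IsSymm) (hIm : (A.map im).PosDef)
    (hiso : ∀ X ∈ L, ∀ Y ∈ L, omega X Y = 0) (hψ : sGerm ψ = graph A) :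
    ∃ Pm : complexify L →ₗ[ℂ] rMinus L ψ, IsPMinus Pm :=
  ⟨((germProj A).domRestrict (complexify L)).codRestrict _ fun Z =>
      (map_germProj_complexify hA hIm hiso hψ).le ⟨Z, Z.2, rfl⟩,
    fun X => (germProj_add_star_toC hIm X).symm⟩

theorem IsPMinus.coe_apply (hPm : IsPMinus Pm) (hIm : (A.map im).PosDef)
    (hψ : sGerm ψ = graph A) (Z : complexify L) : (Pm Z : Phase ℂ n) = germProj A Z := by
  suffices h : (rMinus L ψ).subtype ∘ₗ Pm = (germProj A).domRestrict (complexify L) from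
    LinearMap.congr_fun h Z
  refine (complexBasis (Module.finBasis ℝ L)).ext fun a => ?_
  rw [complexBasis_apply]
  set X := Module.finBasis ℝ L a
  have hX : (Pm (inC L X) : Phase ℂ n) ∈ graph A := hψ.le (Pm (inC L X)).2.1
  change (Pm (inC L X) : Phase ℂ n) = germProj A (toC X)
  rw [hPm X, map_add, germProj_eq_self hIm hX, germProj_star_eq_zero hX, add_zero]

theorem IsPMinus.eq (hPm : IsPMinus Pm) {Pm' : complexify L →ₗ[ℂ] rMinus L ψ}
    (hPm' : IsPMinus Pm') (hIm : (A.map im).PosDef) (hψ : sGerm ψ = graph A) : Pm' = Pm :=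
  LinearMap.ext fun Z => Subtype.ext (by rw [hPm'.coe_apply hIm hψ, hPm.coe_apply hIm hψ])

theorem IsPMinus.bijective (hPm : IsPMinus Pm) (hA : A.IsSymm) (hIm : (A.map im).PosDef)
    (hiso : ∀ X ∈ L, ∀ Y ∈ L, omega X Y = 0) (hψ : sGerm ψ = graph A) :
    Function.Bijective Pm := by
  refine ⟨(injective_iff_map_eq_zero _).2 fun Z hZ => Subtype.ext ?_, fun Y => ?_⟩
  · refine eq_zero_of_mem_complexify_of_germProj_eq_zero hA hIm hiso Z.2 ?_
    rw [← hPm.coe_apply hIm hψ, hZ, ZeroMemClass.coe_zero]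
  · obtain ⟨Z, hZ, hZY⟩ := (map_germProj_complexify hA hIm hiso hψ).ge Y.2
    exact ⟨⟨Z, hZ⟩, Subtype.ext ((hPm.coe_apply hIm hψ _).trans hZY)⟩

end PMinus

section Pi

variable {R : Submodule ℂ (Phase ℂ n)} {Pr : R →ₗ[ℂ] complexify L}

theorem exists_isPi (hdisj : Disjoint (complexify L) (rPerp L ψ)) :
    ∃ Pr : ↥(complexify L ⊔ rPerp L ψ) →ₗ[ℂ] complexify L, IsPi L ψ Pr := by
  obtain ⟨S, hS, hcompl⟩ := hdisj.symm.exists_isCompl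
  refine ⟨(complexify L).projectionOnto S hcompl.symm ∘ₗ Submodule.subtype _, fun Y => ?_⟩
  obtain ⟨Z, hZ, W, hW, hY⟩ := Submodule.mem_sup.1 Y.2
  rw [LinearMap.comp_apply, Submodule.subtype_apply, ← hY, map_add,
    Submodule.projectionOnto_apply_of_mem_left _ hZ,
    (Submodule.projectionOnto_apply_eq_zero_iff _).2 (hS hW), add_zero, add_sub_cancel_left]
  exact hW

theorem IsPi.apply_eq (hPr : IsPi L ψ Pr) (hdisj : Disjoint (complexify L) (rPerp L ψ)) {Y : R}
    {Z : complexify L} (hYZ : (Y : Phase ℂ n) - Z ∈ rPerp L ψ) : Pr Y = Z := by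
  have h := Submodule.sub_mem _ hYZ (hPr Y)
  rw [sub_sub_sub_cancel_left] at h
  exact Subtype.ext (sub_eq_zero.1
    (Submodule.disjoint_def.1 hdisj _ (Submodule.sub_mem _ (Pr Y).2 Z.2) h))

theorem IsPi.eq (hPr : IsPi L ψ Pr) (hdisj : Disjoint (complexify L) (rPerp L ψ))
    {Pr' : R →ₗ[ℂ] complexify L} (hPr' : IsPi L ψ Pr') : Pr' = Pr :=
  LinearMap.ext fun Y => (hPr.apply_eq hdisj (hPr' Y)).symm

theorem IsPi.graphMap_sub (hPr : IsPi L ψ Pr) (hψ : sGerm ψ = graph A) (Y : R) :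
    graphMap A ((Y : Phase ℂ n).2 - (Pr Y : Phase ℂ n).2) = Y - Pr Y :=
  graphMap_snd_of_mem (hψ.le (hPr Y).1)

end Pi

section CalPMinus

variable {R : Submodule ℂ (Phase ℂ n)} {Pm : complexify L →ₗ[ℂ] rMinus L ψ}
  {PP : R →ₗ[ℂ] sGerm ψ} {Pr : R →ₗ[ℂ] complexify L}

theorem exists_isCalPMinus (hPr : IsPi L ψ Pr) (hdisj : Disjoint (complexify L) (rPerp L ψ))
    (Pm : complexify L →ₗ[ℂ] rMinus L ψ) : ∃ PP : R →ₗ[ℂ] sGerm ψ, IsCalPMinus Pm PP := by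
  let PP : R →ₗ[ℂ] sGerm ψ := Submodule.inclusion (rMinus_le L ψ) ∘ₗ Pm ∘ₗ Pr +
    (R.subtype - (complexify L).subtype ∘ₗ Pr).codRestrict _ fun Y => (hPr Y).1
  have hPP : ∀ Y, (PP Y : Phase ℂ n) = Pm (Pr Y) + (Y - Pr Y : Phase ℂ n) := fun _ => rfl
  refine ⟨PP, fun Y hY => ?_, fun Y hY => ?_⟩
  · have hPrY : Pr Y = 0 := hPr.apply_eq hdisj (by rwa [ZeroMemClass.coe_zero, sub_zero])
    rw [hPP, hPrY, map_zero, ZeroMemClass.coe_zero, ZeroMemClass.coe_zero, zero_add, sub_zero]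
  · have hPrY : Pr Y = ⟨Y, hY⟩ := hPr.apply_eq hdisj (by rw [sub_self]; exact Submodule.zero_mem _)
    rw [hPP, hPrY, sub_self, add_zero]

theorem IsCalPMinus.coe_apply (hPP : IsCalPMinus Pm PP) (hPr : IsPi L ψ Pr)
    (hLR : complexify L ≤ R) (Y : R) :
    (PP Y : Phase ℂ n) = Pm (Pr Y) + (Y - Pr Y : Phase ℂ n) := by
  set Z : R := Submodule.inclusion hLR (Pr Y)
  have hZ : (PP Z : Phase ℂ n) = Pm (Pr Y) := hPP.2 Z (Pr Y).2
  have hW : (PP (Y - Z) : Phase ℂ n) = Y - Pr Y := hPP.1 (Y - Z) (hPr Y)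
  rw [← hZ, ← hW, ← Submodule.coe_add, ← map_add, add_sub_cancel]

theorem IsCalPMinus.eq (hPP : IsCalPMinus Pm PP) (hPr : IsPi L ψ Pr) (hLR : complexify L ≤ R)
    {PP' : R →ₗ[ℂ] sGerm ψ} (hPP' : IsCalPMinus Pm PP') : PP' = PP :=
  LinearMap.ext fun Y => Subtype.ext
    (by rw [hPP'.coe_apply hPr hLR, hPP.coe_apply hPr hLR])

end CalPMinus

end GermOperators

section Moments

variable {ι : Type} [Fintype ι] {S : Matrix ι ι ℂ}

theorem integral_dotProduct_mulVec_add_mul_gaussExp (hS : S.IsSymm) (hre : (S.map re).PosDef)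
    (b w : ι → ℂ) (κ : ℂ) :
    ∫ x, (w ⬝ᵥ S *ᵥ cvec x + κ) * gaussExp S b x = (I * (b ⬝ᵥ w) + κ) * ∫ x, gaussExp S b x := by
  have hcentred := integral_affine_mul_gaussExp hS hre b 0 w 1
  simp only [zero_dotProduct, zero_add, one_mul, zero_mul] at hcentred
  calc _ = ∫ x, ((w ⬝ᵥ S *ᵥ cvec x - I * (b ⬝ᵥ w)) * gaussExp S b x +
        (I * (b ⬝ᵥ w) + κ) * gaussExp S b x) := by
        congr 1 with x
        ring
    _ = _ := by
        rw [integral_add (integrable_mul_gaussExp hre b (by fun_prop))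
          ((integrable_gaussExp hre b).const_mul _), hcentred, zero_add, integral_const_mul]

theorem integral_dotProduct_mulVec_mul_add_mul_gaussExp (hS : S.IsSymm)
    (hre : (S.map re).PosDef) (b z w : ι → ℂ) (κ : ℂ) :
    ∫ x, (z ⬝ᵥ S *ᵥ cvec x) * (w ⬝ᵥ S *ᵥ cvec x + κ) * gaussExp S b x =
      (z ⬝ᵥ S *ᵥ w + I * (b ⬝ᵥ z) * (I * (b ⬝ᵥ w) + κ)) * ∫ x, gaussExp S b x := by
  have hw : ∀ x, w ⬝ᵥ S *ᵥ cvec x = S *ᵥ w ⬝ᵥ cvec x := fun x => by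
    rw [dotProduct_mulVec_comm hS, dotProduct_comm]
  calc _ = ∫ x, ((S *ᵥ w ⬝ᵥ cvec x + κ) * (z ⬝ᵥ S *ᵥ cvec x - I * (b ⬝ᵥ z)) * gaussExp S b x +
        I * (b ⬝ᵥ z) * ((w ⬝ᵥ S *ᵥ cvec x + κ) * gaussExp S b x)) := by
        congr 1 with x
        rw [hw]
        ring
    _ = _ := by
        rw [integral_add (integrable_mul_gaussExp hre b (by fun_prop))
            ((integrable_mul_gaussExp hre b (by fun_prop)).const_mul _), integral_const_mul,
          integral_affine_mul_gaussExp hS hre, integral_dotProduct_mulVec_add_mul_gaussExp hS hre,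
          dotProduct_comm (S *ᵥ w)]
        ring

end Moments

section GaussianGerm

variable {n : ℕ} {A : Matrix (Fin n) (Fin n) ℂ}

theorem gaussian_apply (c : ℂ) (A : Matrix (Fin n) (Fin n) ℂ) (ξ : Fin n → ℝ) :
    gaussian c A ξ = c * exp (I / 2 * (cvec ξ ⬝ᵥ A *ᵥ cvec ξ)) := by
  simp only [gaussian, dotProduct, mulVec, Finset.mul_sum, mul_assoc, cvec_apply]

theorem gaussian_eq_gaussExp (c : ℂ) (A : Matrix (Fin n) (Fin n) ℂ) :
    gaussian c A = fun ξ => c * gaussExp (-I • A) 0 ξ := by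
  ext ξ
  rw [gaussian_apply, gaussExp, smul_mulVec, dotProduct_smul, zero_dotProduct, smul_eq_mul]
  ring_nf

theorem map_re_neg_I_smul (A : Matrix (Fin n) (Fin n) ℂ) : (-I • A).map re = A.map im := by
  ext
  simp

theorem gaussian_ne_zero {c : ℂ} (hc : c ≠ 0) (ξ : Fin n → ℝ) : gaussian c A ξ ≠ 0 :=
  mul_ne_zero hc (exp_ne_zero _)

theorem fderiv_gaussian (hA : A.IsSymm) (c : ℂ) (ξ v : Fin n → ℝ) :
    fderiv ℝ (gaussian c A) ξ v = I * (cvec v ⬝ᵥ A *ᵥ cvec ξ) * gaussian c A ξ := by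
  rw [gaussian_eq_gaussExp, fderiv_const_mul (differentiable_gaussExp _ _ ξ), _root_.smul_apply,
    fderiv_gaussExp (hA.smul (-I)), smul_mulVec, dotProduct_smul, zero_dotProduct, smul_eq_mul,
    smul_eq_mul]
  ring

theorem Omega_gaussian (hA : A.IsSymm) (c : ℂ) (Y : Phase ℂ n) (ξ : Fin n → ℝ) :
    Omega Y (gaussian c A) ξ = ((Y.1 - A *ᵥ Y.2) ⬝ᵥ cvec ξ) * gaussian c A ξ := by
  rw [sub_dotProduct, dotProduct_comm (A *ᵥ Y.2), dotProduct_mulVec_comm hA, Omega]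
  simp only [fderiv_gaussian hA, cvec_single, single_dotProduct, one_mul]
  simp only [dotProduct, sub_mul, Finset.sum_mul, Finset.sum_sub_distrib, cvec_apply]
  congr 1
  refine Finset.sum_congr rfl fun j _ => ?_
  rw [mul_assoc I, ← mul_assoc (1 / I), one_div_mul_cancel I_ne_zero, one_mul, mul_assoc]

theorem sGerm_gaussian (hA : A.IsSymm) {c : ℂ} (hc : c ≠ 0) : sGerm (gaussian c A) = graph A := by
  ext Y
  have hmem : Y ∈ sGerm (gaussian c A) ↔ ∀ ξ, Omega Y (gaussian c A) ξ = 0 := Iff.rfl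
  simp only [hmem, mem_graph_iff, Omega_gaussian hA, mul_eq_zero, gaussian_ne_zero hc, or_false]
  refine ⟨fun h => sub_eq_zero.1 (funext fun j => ?_), fun h ξ => by
    rw [h, sub_self, zero_dotProduct]⟩
  rw [← dotProduct_single_one (Y.1 - A *ᵥ Y.2), ← cvec_single]
  exact h (Pi.single j 1)

end GaussianGerm

section Pairing

variable {n : ℕ} {A : Matrix (Fin n) (Fin n) ℂ}

theorem expOmega_gaussian (hA : A.IsSymm) (c : ℂ) (X : Phase ℝ n) (ξ : Fin n → ℝ) :
    expOmega X (gaussian c A) ξ = gaussian c A ξ *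
      exp (I * ((cvec X.1 - A *ᵥ cvec X.2) ⬝ᵥ (cvec ξ - (1 / 2 : ℂ) • cvec X.2))) := by
  rw [expOmega, gaussian_apply, gaussian_apply, mul_left_comm, mul_assoc, ← exp_add, ← exp_add]
  congr 2
  simp only [cvec_sub, mulVec_sub, dotProduct_sub, sub_dotProduct, dotProduct_smul, smul_eq_mul,
    dotProduct_comm (A *ᵥ cvec X.2)]
  rw [dotProduct_mulVec_comm hA (cvec ξ) (cvec X.2), cvec_dotProduct, cvec_dotProduct]
  push_cast
  ring

theorem star_gaussian (c : ℂ) (A : Matrix (Fin n) (Fin n) ℂ) (ξ : Fin n → ℝ) :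
    star (gaussian c A ξ) = star c * exp (-(I / 2) * (cvec ξ ⬝ᵥ A.map star *ᵥ cvec ξ)) := by
  have hconj : star (cvec ξ ⬝ᵥ A *ᵥ cvec ξ) = cvec ξ ⬝ᵥ A.map star *ᵥ cvec ξ := by
    rw [← star_dotProduct_star, star_mulVec_map_star, star_cvec, dotProduct_comm]
  rw [gaussian_apply, star_mul', ← hconj]
  simp only [RCLike.star_def, ← Complex.exp_conj, map_mul, map_div₀, conj_I, map_ofNat, neg_div]

theorem star_gaussian_mul_expOmega (hA : A.IsSymm) (c : ℂ) (X : Phase ℝ n) (ξ : Fin n → ℝ) :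
    star (gaussian c A ξ) * expOmega X (gaussian c A) ξ = star c * c *
      exp (-(I / 2) * ((cvec X.1 - A *ᵥ cvec X.2) ⬝ᵥ cvec X.2)) *
        gaussExp (normMatrix A) (cvec X.1 - A *ᵥ cvec X.2) ξ := by
  rw [expOmega_gaussian hA, star_gaussian, gaussian_apply, gaussExp, normMatrix, smul_mulVec,
    sub_mulVec, dotProduct_smul, dotProduct_sub, smul_eq_mul, dotProduct_sub, dotProduct_smul,
    smul_eq_mul]
  calc _ = star c * c * exp (-(I / 2) * (cvec ξ ⬝ᵥ A.map star *ᵥ cvec ξ) +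
        (I / 2 * (cvec ξ ⬝ᵥ A *ᵥ cvec ξ) + I * ((cvec X.1 - A *ᵥ cvec X.2) ⬝ᵥ cvec ξ -
          1 / 2 * ((cvec X.1 - A *ᵥ cvec X.2) ⬝ᵥ cvec X.2)))) := by
        rw [exp_add, exp_add]
        ring
    _ = _ := by
        rw [mul_assoc (star c * c), ← exp_add]
        congr 2
        ring

/-- The squared norm `(ψ_A, ψ_A)` of the Gaussian `ψ_A`. -/
def gaussNormSq (c : ℂ) (A : Matrix (Fin n) (Fin n) ℂ) : ℂ :=
  star c * c * gaussConst (normMatrix A)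

theorem gaussNormSq_ne_zero {c : ℂ} (hc : c ≠ 0) (hIm : (A.map im).PosDef) :
    gaussNormSq c A ≠ 0 :=
  mul_ne_zero (mul_ne_zero (star_ne_zero.2 hc) hc)
    (gaussConst_ne_zero (isSymm_normMatrix hIm) (posDef_normMatrix hIm))

theorem normMatrix_mulVec_star_germCoord_toC (hIm : (A.map im).PosDef) (X : Phase ℝ n) :
    normMatrix A *ᵥ star (germCoord A (toC X)) = I • (cvec X.1 - A *ᵥ cvec X.2) := by
  have h := normMatrix_mulVec_star_germCoord hIm (toC X)
  rw [star_toC, toC_eq_cvec] at h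
  rw [toC_eq_cvec, ← neg_neg (cvec X.1 - A *ᵥ cvec X.2), ← h, smul_neg, smul_smul, I_mul_I,
    neg_one_smul, neg_neg]

theorem germCoord_toC_add_star (hIm : (A.map im).PosDef) (X : Phase ℝ n) :
    germCoord A (toC X) + star (germCoord A (toC X)) = cvec X.2 := by
  have h := germCoord_add_star hIm (toC X)
  rwa [star_toC] at h

theorem pairing_gaussian_expOmega (hA : A.IsSymm) (hIm : (A.map im).PosDef) (c : ℂ)
    (X : Phase ℝ n) :
    pairing (gaussian c A) (expOmega X (gaussian c A)) = gaussNormSq c A *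
      exp (-(1 / 2) * hermForm (germProj A (toC X)) (germProj A (toC X))) := by
  have hNp := normMatrix_mulVec_star_germCoord_toC hIm X
  set p := germCoord A (toC X) with hp
  set b := cvec X.1 - A *ᵥ cvec X.2
  have hz : normMatrix A *ᵥ (-I • star p) = b := by
    rw [mulVec_smul, hNp, smul_smul, neg_mul, I_mul_I, neg_neg, one_smul]
  have hexponent : -(I / 2) * (b ⬝ᵥ cvec X.2) + -(1 / 2) * (b ⬝ᵥ -I • star p) =
      -(1 / 2) * (p ⬝ᵥ normMatrix A *ᵥ star p) := by
    rw [hNp, ← germCoord_toC_add_star hIm X, dotProduct_comm p, dotProduct_add, dotProduct_smul,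
      smul_dotProduct, smul_eq_mul, smul_eq_mul]
    ring
  simp only [pairing, star_gaussian_mul_expOmega hA]
  rw [integral_const_mul, integral_gaussExp (isSymm_normMatrix hIm) (posDef_normMatrix hIm) hz,
    germProj_apply, hermForm_graphMap hA, ← hp, ← hexponent, exp_add, gaussNormSq]
  ring

theorem star_dotProduct_normMatrix_mulVec_cvec (w : Fin n → ℂ) (ξ : Fin n → ℝ) :
    star (w ⬝ᵥ normMatrix A *ᵥ cvec ξ) = star w ⬝ᵥ normMatrix A *ᵥ cvec ξ := by
  rw [← star_dotProduct_star, normMatrix_eq, map_ofReal_mulVec_cvec, star_cvec, dotProduct_comm]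

theorem Omega_gaussian_eq_normMatrix (hA : A.IsSymm) (hIm : (A.map im).PosDef) (c : ℂ)
    (Y : Phase ℂ n) (ξ : Fin n → ℝ) :
    Omega Y (gaussian c A) ξ =
      -I * (star (germCoord A (star Y)) ⬝ᵥ normMatrix A *ᵥ cvec ξ) * gaussian c A ξ := by
  rw [Omega_gaussian hA, dotProduct_mulVec_comm (isSymm_normMatrix hIm), neg_mul, ← smul_eq_mul I,
    ← dotProduct_smul, normMatrix_mulVec_star_germCoord hIm, dotProduct_neg, neg_neg,
    dotProduct_comm]

theorem pairing_Omega_gaussian (hA : A.IsSymm) (hIm : (A.map im).PosDef) (c : ℂ)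
    (X : Phase ℝ n) (Y : Phase ℂ n) :
    pairing (Omega Y (gaussian c A)) (expOmega X (Omega Y (gaussian c A))) =
      (hermForm (germProj A (star Y)) (germProj A (star Y)) -
        hermForm (germProj A (star Y)) (germProj A (toC X)) *
          hermForm (germProj A (toC X)) (germProj A (star Y))) *
      pairing (gaussian c A) (expOmega X (gaussian c A)) := by
  set N := normMatrix A with hN
  set z := germCoord A (star Y) with hz
  set p := germCoord A (toC X) with hp
  set b := cvec X.1 - A *ᵥ cvec X.2
  have hI : star I = -I := conj_I
  have hNs : N.IsSymm := isSymm_normMatrix hIm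
  have hNp : N *ᵥ star p = I • b := normMatrix_mulVec_star_germCoord_toC hIm X
  have hintegrand : ∀ ξ, star (Omega Y (gaussian c A) ξ) * expOmega X (Omega Y (gaussian c A)) ξ =
      (z ⬝ᵥ N *ᵥ cvec ξ) * (star z ⬝ᵥ N *ᵥ cvec ξ + -(star z ⬝ᵥ N *ᵥ cvec X.2)) *
        (star (gaussian c A ξ) * expOmega X (gaussian c A) ξ) := fun ξ => by
    have hshift : expOmega X (Omega Y (gaussian c A)) ξ =
        -I * (star z ⬝ᵥ N *ᵥ cvec ξ - star z ⬝ᵥ N *ᵥ cvec X.2) * expOmega X (gaussian c A) ξ := by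
      rw [expOmega, expOmega, Omega_gaussian_eq_normMatrix hA hIm, cvec_sub, mulVec_sub,
        dotProduct_sub]
      ring
    rw [hshift, Omega_gaussian_eq_normMatrix hA hIm, star_mul', star_mul',
      star_dotProduct_normMatrix_mulVec_cvec, star_star, star_neg, hI, ← hN, ← hz]
    linear_combination -((z ⬝ᵥ N *ᵥ cvec ξ) * (star z ⬝ᵥ N *ᵥ cvec ξ - star z ⬝ᵥ N *ᵥ cvec X.2) *
      (star (gaussian c A ξ) * expOmega X (gaussian c A) ξ)) * I_mul_I
  have hbz : I * (b ⬝ᵥ z) = z ⬝ᵥ N *ᵥ star p := by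
    rw [hNp, dotProduct_smul, smul_eq_mul, dotProduct_comm]
  have hbw : I * (b ⬝ᵥ star z) + -(star z ⬝ᵥ N *ᵥ cvec X.2) = -(p ⬝ᵥ N *ᵥ star z) := by
    rw [← germCoord_toC_add_star hIm X, ← hp, mulVec_add, dotProduct_add, hNp, dotProduct_smul,
      smul_eq_mul, dotProduct_comm b, dotProduct_mulVec_comm hNs p]
    ring
  simp only [pairing, hintegrand, star_gaussian_mul_expOmega hA, mul_left_comm _ (star c * c * _)]
  rw [integral_const_mul, integral_const_mul,
    integral_dotProduct_mulVec_mul_add_mul_gaussExp hNs (posDef_normMatrix hIm), hbz, hbw,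
    germProj_apply, germProj_apply, hermForm_graphMap hA, hermForm_graphMap hA,
    hermForm_graphMap hA]
  ring

end Pairing

section GramMatrix

variable {n k : ℕ} {A : Matrix (Fin n) (Fin n) ℂ} {L : Submodule ℝ (Phase ℝ n)}

/-- The Gram matrix, for the form `(1/i) ω(Y, Y'*)`, of the components on the graph of `A` of a
basis `e` of `L`; it is real because `L` is isotropic. -/
def gramMatrix (A : Matrix (Fin n) (Fin n) ℂ) (e : Module.Basis (Fin k) ℝ L) :
    Matrix (Fin k) (Fin k) ℝ :=
  Matrix.of fun a b => (hermForm (germProj A (toC (e a))) (germProj A (toC (e b)))).re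

theorem gramMatrix_map_ofReal (hA : A.IsSymm) (hIm : (A.map im).PosDef)
    (hiso : ∀ X ∈ L, ∀ Y ∈ L, omega X Y = 0) (e : Module.Basis (Fin k) ℝ L) :
    (gramMatrix A e).map ofReal = Matrix.of fun a b =>
      hermForm (germProj A (toC (e a))) (germProj A (toC (e b))) := by
  ext a b
  have h := hermForm_eq_sub hA hIm (toC (e a : Phase ℝ n)) (toC (e b))
  rw [hermForm_eq_zero_of_mem_complexify hiso (toC_mem_complexify (e a).2)
    (toC_mem_complexify (e b).2), star_toC, star_toC, eq_comm, sub_eq_zero] at h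
  exact conj_eq_iff_re.1 h.symm

theorem hermForm_germProj_sum (hA : A.IsSymm) (hIm : (A.map im).PosDef)
    (hiso : ∀ X ∈ L, ∀ Y ∈ L, omega X Y = 0) (e : Module.Basis (Fin k) ℝ L) (z w : Fin k → ℂ) :
    hermForm (germProj A (∑ a, z a • toC (e a))) (germProj A (∑ a, w a • toC (e a))) =
      z ⬝ᵥ (gramMatrix A e).map ofReal *ᵥ star w := by
  simp only [map_sum, map_smul, hermForm_sum_smul, gramMatrix_map_ofReal hA hIm hiso]

theorem posDef_gramMatrix (hA : A.IsSymm) (hIm : (A.map im).PosDef)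
    (hiso : ∀ X ∈ L, ∀ Y ∈ L, omega X Y = 0) (e : Module.Basis (Fin k) ℝ L) :
    (gramMatrix A e).PosDef := by
  refine PosDef.of_dotProduct_mulVec_pos ?_ fun x hx => ?_
  · ext a b
    rw [conjTranspose_apply, star_trivial, gramMatrix, of_apply, of_apply, ← star_hermForm]
    exact conj_re _
  · set X : L := e.equivFun.symm x with hX
    have hgerm : germProj A (toC X) ≠ 0 := fun h => hx <| by
      have hX0 := eq_zero_of_mem_complexify_of_germProj_eq_zero hA hIm hiso
        (toC_mem_complexify X.2) h
      have hX1 : (X : Phase ℝ n) = 0 := (eq_zero_of_toC_add_I_smul_toC_eq_zero (Y := 0)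
        (by rw [hX0, toC_zero, smul_zero, add_zero])).1
      rwa [hX, Submodule.coe_eq_zero, LinearEquiv.map_eq_zero_iff] at hX1
    have hpos := re_hermForm_self_pos hA hIm (germProj_mem_graph _) hgerm
    rwa [hX, toC_equivFun_symm, hermForm_germProj_sum hA hIm hiso, star_cvec,
      map_ofReal_mulVec_cvec, cvec_dotProduct, ofReal_re] at hpos

end GramMatrix

section HaarCoordinates

variable {ι E F : Type} [Fintype ι] [NormedAddCommGroup E] [NormedSpace ℝ E]
  [MeasurableSpace E] [NormedAddCommGroup F]

theorem measure_parallelepiped_ne_zero (μ : Measure E) [μ.IsAddHaarMeasure]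
    (e : Module.Basis ι ℝ E) : μ (parallelepiped e) ≠ 0 := by
  rw [← Module.Basis.coe_parallelepiped]
  exact (Measure.measure_pos_of_nonempty_interior μ e.parallelepiped.interior_nonempty).ne'

theorem measure_parallelepiped_ne_top (μ : Measure E) [μ.IsAddHaarMeasure]
    (e : Module.Basis ι ℝ E) : μ (parallelepiped e) ≠ ⊤ := by
  rw [← Module.Basis.coe_parallelepiped]
  exact e.parallelepiped.isCompact.measure_lt_top.ne

variable [BorelSpace E]

theorem measurableEmbedding_equivFunL_symm {κ : Type} [Finite κ] (e : Module.Basis κ ℝ E) :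
    MeasurableEmbedding e.equivFunL.symm :=
  e.equivFunL.symm.toHomeomorph.measurableEmbedding

variable [FiniteDimensional ℝ E]

theorem map_equivFunL_symm_volume (e : Module.Basis ι ℝ E) :
    Measure.map e.equivFunL.symm volume = e.addHaar := by
  classical
  have hvolume : (volume : Measure (ι → ℝ)) = (Pi.basisFun ℝ ι).addHaar := by
    rw [Module.Basis.addHaar_def, Module.Basis.parallelepiped_basisFun,
      addHaarMeasure_eq_volume_pi]
  rw [hvolume, Module.Basis.map_addHaar]
  congr 1
  ext i
  rw [Module.Basis.map_apply, Pi.basisFun_apply]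
  change e.equivFun.symm (Pi.single i 1) = e i
  simp only [Module.Basis.equivFun_symm_apply, Pi.single_apply, ite_smul, one_smul, zero_smul,
    Finset.sum_ite_eq', Finset.mem_univ, if_true]

theorem haar_eq_smul_map_equivFunL_symm (μ : Measure E) [μ.IsAddHaarMeasure]
    (e : Module.Basis ι ℝ E) :
    μ = μ (parallelepiped e) • Measure.map e.equivFunL.symm volume := by
  have h := Measure.addHaarMeasure_unique μ e.parallelepiped
  rwa [← Module.Basis.addHaar_def, Module.Basis.coe_parallelepiped,
    ← map_equivFunL_symm_volume] at h

theorem integral_haar_eq [NormedSpace ℝ F] (μ : Measure E) [μ.IsAddHaarMeasure]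
    (e : Module.Basis ι ℝ E) (f : E → F) :
    ∫ X, f X ∂μ = (μ (parallelepiped e)).toReal • ∫ x, f (e.equivFun.symm x) := by
  conv_lhs => rw [haar_eq_smul_map_equivFunL_symm μ e]
  rw [integral_smul_measure, (measurableEmbedding_equivFunL_symm e).integral_map f]
  rfl

theorem integrable_haar_iff (μ : Measure E) [μ.IsAddHaarMeasure] (e : Module.Basis ι ℝ E)
    (f : E → F) : Integrable f μ ↔ Integrable fun x => f (e.equivFun.symm x) := by
  conv_lhs => rw [haar_eq_smul_map_equivFunL_symm μ e]
  rw [integrable_smul_measure (measure_parallelepiped_ne_zero μ e)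
    (measure_parallelepiped_ne_top μ e),
    (measurableEmbedding_equivFunL_symm e).integrable_map_iff]
  rfl

end HaarCoordinates

section ConstrInner

variable {n k : ℕ} {A : Matrix (Fin n) (Fin n) ℂ} {L : Submodule ℝ (Phase ℝ n)} {c : ℂ}
  {Y W : Phase ℂ n}

theorem pairing_gaussian_expOmega_equivFun_symm (hA : A.IsSymm) (hIm : (A.map im).PosDef)
    (hiso : ∀ X ∈ L, ∀ Y ∈ L, omega X Y = 0) (e : Module.Basis (Fin k) ℝ L) (x : Fin k → ℝ) :
    pairing (gaussian c A) (expOmega (e.equivFun.symm x : Phase ℝ n) (gaussian c A)) =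
      gaussNormSq c A * gaussExp ((gramMatrix A e).map ofReal) 0 x := by
  rw [pairing_gaussian_expOmega hA hIm, toC_equivFun_symm, hermForm_germProj_sum hA hIm hiso,
    star_cvec, gaussExp, zero_dotProduct, mul_zero, add_zero]

theorem pairing_Omega_gaussian_equivFun_symm (hA : A.IsSymm) (hIm : (A.map im).PosDef)
    (hc : c ≠ 0) (hiso : ∀ X ∈ L, ∀ Y ∈ L, omega X Y = 0) (e : Module.Basis (Fin k) ℝ L)
    {z : Fin k → ℂ} (hW : W ∈ rPerp L (gaussian c A))
    (hY : germProj A (star Y) = germProj A (∑ a, z a • toC (e a)) + W) (x : Fin k → ℝ) :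
    pairing (Omega Y (gaussian c A))
        (expOmega (e.equivFun.symm x : Phase ℝ n) (Omega Y (gaussian c A))) =
      (z ⬝ᵥ (gramMatrix A e).map ofReal *ᵥ star z + hermForm W W -
        (z ⬝ᵥ (gramMatrix A e).map ofReal *ᵥ cvec x) *
          (star z ⬝ᵥ (gramMatrix A e).map ofReal *ᵥ cvec x + 0)) *
      (gaussNormSq c A * gaussExp ((gramMatrix A e).map ofReal) 0 x) := by
  have hψ := sGerm_gaussian hA hc
  have hBs := isSymm_map_ofReal (posDef_gramMatrix hA hIm hiso e)
  have hsum : ∀ w : Fin k → ℂ, ∑ a, w a • toC (e a) ∈ complexify L := fun w =>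
    Submodule.sum_mem _ fun a _ => Submodule.smul_mem _ _ (toC_mem_complexify (e a).2)
  have hright : ∀ w : Fin k → ℂ, hermForm W (germProj A (∑ a, w a • toC (e a))) = 0 := fun w =>
    hermForm_germProj_eq_zero hA hIm hψ hW (hsum w)
  have hleft : ∀ w : Fin k → ℂ, hermForm (germProj A (∑ a, w a • toC (e a))) W = 0 := fun w => by
    rw [← star_hermForm, hright, star_zero]
  rw [pairing_Omega_gaussian hA hIm, pairing_gaussian_expOmega_equivFun_symm hA hIm hiso, hY,
    toC_equivFun_symm]
  simp only [hermForm_add_left, hermForm_add_right, hleft, hright, add_zero, zero_add,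
    hermForm_germProj_sum hA hIm hiso, star_cvec]
  rw [dotProduct_mulVec_comm hBs (cvec x)]

theorem constrInner_Omega_gaussian (hA : A.IsSymm) (hIm : (A.map im).PosDef) (hc : c ≠ 0)
    (hiso : ∀ X ∈ L, ∀ Y ∈ L, omega X Y = 0) (μ : Measure L) [μ.IsAddHaarMeasure]
    (e : Module.Basis (Fin k) ℝ L) {z : Fin k → ℂ} (hW : W ∈ rPerp L (gaussian c A))
    (hY : germProj A (star Y) = germProj A (∑ a, z a • toC (e a)) + W) :
    constrInner L μ (Omega Y (gaussian c A)) (Omega Y (gaussian c A)) =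
      (μ (parallelepiped e)).toReal *
        (gaussNormSq c A * gaussConst ((gramMatrix A e).map ofReal) * hermForm W W) := by
  have hBs := isSymm_map_ofReal (posDef_gramMatrix hA hIm hiso e)
  have hBre : (((gramMatrix A e).map ofReal).map re).PosDef := by
    rw [map_re_map_ofReal]
    exact posDef_gramMatrix hA hIm hiso e
  rw [constrInner, integral_haar_eq μ e]
  simp only [pairing_Omega_gaussian_equivFun_symm hA hIm hc hiso e hW hY]
  set B := (gramMatrix A e).map ofReal
  have hsplit : ∀ x, (z ⬝ᵥ B *ᵥ star z + hermForm W W -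
      (z ⬝ᵥ B *ᵥ cvec x) * (star z ⬝ᵥ B *ᵥ cvec x + 0)) * (gaussNormSq c A * gaussExp B 0 x) =
      gaussNormSq c A * ((z ⬝ᵥ B *ᵥ star z + hermForm W W) * gaussExp B 0 x -
        (z ⬝ᵥ B *ᵥ cvec x) * (star z ⬝ᵥ B *ᵥ cvec x + 0) * gaussExp B 0 x) := fun x => by ring
  simp only [hsplit]
  rw [integral_const_mul, integral_sub ((integrable_gaussExp hBre 0).const_mul _)
    (integrable_mul_gaussExp hBre 0 (by fun_prop)), integral_const_mul,
    integral_dotProduct_mulVec_mul_add_mul_gaussExp hBs hBre, zero_dotProduct, ← gaussConst,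
    real_smul]
  ring

theorem constrInner_Omega_gaussian_eq_zero_iff (hA : A.IsSymm) (hIm : (A.map im).PosDef)
    (hc : c ≠ 0) (hiso : ∀ X ∈ L, ∀ Y ∈ L, omega X Y = 0) (μ : Measure L) [μ.IsAddHaarMeasure] :
    constrInner L μ (Omega Y (gaussian c A)) (Omega Y (gaussian c A)) = 0 ↔
      germProj A (star Y) ∈ (complexify L).map (germProj A) := by
  have hψ := sGerm_gaussian hA hc
  let e := Module.finBasis ℝ L
  obtain ⟨_, ⟨Z, hZ, rfl⟩, W, hW, hY⟩ := Submodule.mem_sup.1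
    ((map_germProj_sup_rPerp hA hIm hiso hψ).ge (hψ.ge (germProj_mem_graph (star Y))))
  have hBp := posDef_gramMatrix hA hIm hiso e
  have hvolume : (μ (parallelepiped e)).toReal ≠ 0 := ENNReal.toReal_ne_zero.2
    ⟨measure_parallelepiped_ne_zero μ e, measure_parallelepiped_ne_top μ e⟩
  have hgram : gaussConst ((gramMatrix A e).map ofReal) ≠ 0 :=
    gaussConst_ne_zero (isSymm_map_ofReal hBp) (by rwa [map_re_map_ofReal])
  have hinner := constrInner_Omega_gaussian hA hIm hc hiso μ e
    (z := (complexBasis e).repr ⟨Z, hZ⟩) hW (by rw [sum_repr_complexBasis, hY])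
  rw [hinner, mul_eq_zero_iff_left (ofReal_ne_zero.2 hvolume),
    mul_eq_zero_iff_left (mul_ne_zero (gaussNormSq_ne_zero hc hIm) hgram)]
  refine ⟨fun h => ?_, fun h => ?_⟩
  · rw [← hY, eq_zero_of_hermForm_self_eq_zero hA hIm (hψ.le hW.1) h, add_zero]
    exact ⟨Z, hZ, rfl⟩
  · have hWmap : W ∈ (complexify L).map (germProj A) := by
      rw [← hY] at h
      exact (Submodule.add_mem_iff_right _ (Submodule.mem_map_of_mem hZ)).1 h
    rw [Submodule.disjoint_def.1 (disjoint_map_germProj_rPerp hA hIm hψ) W hWmap hW, hermForm,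
      star_zero]
    simp [omega]

theorem mem_complexify_sup_rPerp_iff {ψ : (Fin n → ℝ) → ℂ} (hIm : (A.map im).PosDef)
    (hiso : ∀ X ∈ L, ∀ Y ∈ L, omega X Y = 0) (hψ : sGerm ψ = graph A) :
    Y ∈ complexify L ⊔ rPerp L ψ ↔ Y ∈ skewOrth (complexify L) ∧
      germProj A (star Y) ∈ (complexify L).map (germProj A) := by
  constructor
  · intro hY
    refine ⟨sup_le (complexify_le_skewOrth hiso) inf_le_right hY, ?_⟩
    obtain ⟨Z, hZ, W, hW, rfl⟩ := Submodule.mem_sup.1 hY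
    rw [star_add, map_add, germProj_star_eq_zero (hψ.le hW.1), add_zero]
    exact ⟨star Z, star_mem_complexify hZ, rfl⟩
  · rintro ⟨hskew, Z, hZ, hZY⟩
    have hZ' := star_mem_complexify hZ
    have hgraph : Y - star Z ∈ graph A := by
      have h := germProj_add_star hIm (Y - star Z)
      rw [star_sub, star_star, map_sub (germProj A) (star Y), hZY, sub_self, star_zero,
        add_zero] at h
      rw [← h]
      exact germProj_mem_graph _
    rw [← add_sub_cancel (star Z) Y]
    exact Submodule.add_mem_sup hZ'
      ⟨hψ.ge hgraph, Submodule.sub_mem _ hskew (complexify_le_skewOrth hiso hZ')⟩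

theorem hGerm_gaussian (hA : A.IsSymm) (hIm : (A.map im).PosDef) (hc : c ≠ 0)
    (hiso : ∀ X ∈ L, ∀ Y ∈ L, omega X Y = 0) (μ : Measure L) [μ.IsAddHaarMeasure] :
    hGerm L μ (gaussian c A) = complexify L ⊔ rPerp L (gaussian c A) := by
  ext Y
  rw [SetLike.mem_coe, mem_complexify_sup_rPerp_iff hIm hiso (sGerm_gaussian hA hc),
    ← constrInner_Omega_gaussian_eq_zero_iff hA hIm hc hiso μ]
  rfl

end ConstrInner

section DiracMatrix

variable {n k : ℕ} {A : Matrix (Fin n) (Fin n) ℂ} {L : Submodule ℝ (Phase ℝ n)}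

/-- The coordinates in the basis `e` of the functional `X ↦ ω(X, (A v, v))` on `L`; for real `v`
this is the linear part of the exponent of `X ↦ e^{iΩ(X)} ψ_A (v)`. -/
def diracVector (A : Matrix (Fin n) (Fin n) ℂ) (e : Module.Basis (Fin k) ℝ L) (v : Fin n → ℂ) :
    Fin k → ℂ := fun a => omega (toC (e a)) (graphMap A v)

/-- The matrix in the basis `e` of the form `i ω(X, C⁻¹ Č X)` on `L`, that is, of the quadratic
part of the exponent of `X ↦ e^{iΩ(X)} ψ_A (ξ)`. -/
def diracMatrix (A : Matrix (Fin n) (Fin n) ℂ) (e : Module.Basis (Fin k) ℝ L) :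
    Matrix (Fin k) (Fin k) ℂ :=
  Matrix.of fun a b => I * omega (toC (e a)) (graphMap A (toC (e b)).2)

theorem diracVector_dotProduct (e : Module.Basis (Fin k) ℝ L) (v : Fin n → ℂ) (z : Fin k → ℂ) :
    diracVector A e v ⬝ᵥ z = omega (∑ a, z a • toC (e a)) (graphMap A v) := by
  simp only [diracVector, dotProduct, omega_sum_smul_left, mul_comm]

theorem diracMatrix_mulVec (e : Module.Basis (Fin k) ℝ L) (w : Fin k → ℂ) :
    diracMatrix A e *ᵥ w = I • diracVector A e (∑ b, w b • toC (e b)).2 := by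
  ext a
  simp only [diracMatrix, diracVector, mulVec, dotProduct, of_apply, Prod.snd_sum, Prod.smul_snd,
    map_sum, map_smul, omega_sum_smul_right, Pi.smul_apply, smul_eq_mul, Finset.mul_sum]
  exact Finset.sum_congr rfl fun b _ => by ring

theorem dotProduct_diracMatrix_mulVec (e : Module.Basis (Fin k) ℝ L) (z w : Fin k → ℂ) :
    z ⬝ᵥ diracMatrix A e *ᵥ w =
      I * omega (∑ a, z a • toC (e a)) (graphMap A (∑ a, w a • toC (e a)).2) := by
  rw [diracMatrix_mulVec, dotProduct_smul, dotProduct_comm, diracVector_dotProduct, smul_eq_mul]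

theorem diracVector_eq_of_graphMap_sub_mem {v v' : Fin n → ℂ}
    (h : graphMap A (v - v') ∈ skewOrth (complexify L)) (e : Module.Basis (Fin k) ℝ L) :
    diracVector A e v = diracVector A e v' := by
  ext a
  have hω : omega (toC (e a)) (graphMap A (v - v')) = 0 := by
    rw [omega_swap, h _ (toC_mem_complexify (e a).2), neg_zero]
  conv_lhs => rw [← sub_add_cancel v v', diracVector, map_add, omega_add_right, hω, zero_add]
  rfl

theorem isSymm_diracMatrix (hA : A.IsSymm) (hiso : ∀ X ∈ L, ∀ Y ∈ L, omega X Y = 0)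
    (e : Module.Basis (Fin k) ℝ L) : (diracMatrix A e).IsSymm := by
  ext a b
  have hω := omega_toC (e a : Phase ℝ n) (e b)
  rw [hiso _ (e a).2 _ (e b).2, ofReal_zero, omega] at hω
  rw [transpose_apply, diracMatrix, of_apply, of_apply, omega_swap, omega_graphMap_left hA,
    omega_swap, omega_graphMap_left hA, sub_dotProduct, sub_dotProduct,
    dotProduct_comm (A *ᵥ _), dotProduct_comm (A *ᵥ _), dotProduct_mulVec_comm hA]
  linear_combination (-I) * hω

theorem posDef_re_diracMatrix (hA : A.IsSymm) (hIm : (A.map im).PosDef)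
    (hiso : ∀ X ∈ L, ∀ Y ∈ L, omega X Y = 0)
    (hproj : Set.InjOn Prod.snd (L : Set (Phase ℝ n))) (e : Module.Basis (Fin k) ℝ L) :
    ((diracMatrix A e).map re).PosDef := by
  refine PosDef.of_dotProduct_mulVec_pos ?_ fun x hx => ?_
  · rw [IsHermitian, conjTranspose_eq_transpose_of_trivial, ← transpose_map,
      (isSymm_diracMatrix hA hiso e).eq]
  · rw [star_trivial, ← re_dotProduct_mulVec_cvec, dotProduct_diracMatrix_mulVec,
      ← toC_equivFun_symm]
    set X := e.equivFun.symm x with hX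
    have hQ : (X : Phase ℝ n).2 ≠ 0 := fun hQ => hx <| by
      have hX0 : X = 0 := Subtype.ext (hproj X.2 L.zero_mem hQ)
      rwa [hX, LinearEquiv.map_eq_zero_iff] at hX0
    have hform : I * omega (toC (X : Phase ℝ n)) (graphMap A (toC (X : Phase ℝ n)).2) =
        (((X : Phase ℝ n).1 ⬝ᵥ (X : Phase ℝ n).2 : ℝ) : ℂ) * I +
          cvec (X : Phase ℝ n).2 ⬝ᵥ (-I • A) *ᵥ cvec (X : Phase ℝ n).2 := by
      rw [omega_swap, omega_graphMap_left hA, neg_neg, toC_eq_cvec, ← cvec_dotProduct,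
        smul_mulVec, dotProduct_smul, smul_eq_mul, sub_dotProduct, dotProduct_comm (A *ᵥ _)]
      ring
    rw [hform, add_re, re_dotProduct_mulVec_cvec, map_re_neg_I_smul, re_ofReal_mul, I_re, mul_zero,
      zero_add]
    exact dotProduct_mulVec_pos hIm hQ

end DiracMatrix

section DiracFunction

variable {n k : ℕ} {A : Matrix (Fin n) (Fin n) ℂ} {L : Submodule ℝ (Phase ℝ n)} {c : ℂ}

/-- The integrand `e^{-(i/2) ω(X, C⁻¹ Č X)}` of the constant of the Dirac wave function: for
`X ∈ L` the point of `r` with the same second component as `X` is `(A Q, Q)`. -/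
def diracWeight (A : Matrix (Fin n) (Fin n) ℂ) (X : Phase ℝ n) : ℂ :=
  Complex.exp (-(I / 2) * omega (toC X) (graphMap A (toC X).2))

theorem diracWeight_equivFun_symm (e : Module.Basis (Fin k) ℝ L) (x : Fin k → ℝ) :
    diracWeight A (e.equivFun.symm x : Phase ℝ n) = gaussExp (diracMatrix A e) 0 x := by
  rw [gaussExp, dotProduct_diracMatrix_mulVec, ← toC_equivFun_symm, zero_dotProduct, diracWeight]
  congr 1
  ring

theorem expOmega_gaussian_equivFun_symm (hA : A.IsSymm) (e : Module.Basis (Fin k) ℝ L)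
    (x : Fin k → ℝ) (ξ : Fin n → ℝ) :
    expOmega (e.equivFun.symm x : Phase ℝ n) (gaussian c A) ξ =
      gaussian c A ξ * gaussExp (diracMatrix A e) (diracVector A e (cvec ξ)) x := by
  rw [expOmega_gaussian hA, gaussExp, diracVector_dotProduct, dotProduct_diracMatrix_mulVec,
    ← toC_equivFun_symm, omega_swap, omega_graphMap_left hA, omega_swap _ (graphMap A (cvec ξ)),
    omega_graphMap_left hA, toC_eq_cvec, dotProduct_sub, dotProduct_smul, smul_eq_mul]
  congr 2
  ring

theorem integrable_expOmega_gaussian (hA : A.IsSymm) (hIm : (A.map im).PosDef)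
    (hiso : ∀ X ∈ L, ∀ Y ∈ L, omega X Y = 0)
    (hproj : Set.InjOn Prod.snd (L : Set (Phase ℝ n))) (μ : Measure L) [μ.IsAddHaarMeasure]
    (ξ : Fin n → ℝ) :
    Integrable (fun X : L => expOmega (X : Phase ℝ n) (gaussian c A) ξ) μ := by
  rw [integrable_haar_iff μ (Module.finBasis ℝ L)]
  simp only [expOmega_gaussian_equivFun_symm hA]
  exact (integrable_gaussExp (posDef_re_diracMatrix hA hIm hiso hproj _) _).const_mul _

theorem integrable_diracWeight (hA : A.IsSymm) (hIm : (A.map im).PosDef)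
    (hiso : ∀ X ∈ L, ∀ Y ∈ L, omega X Y = 0)
    (hproj : Set.InjOn Prod.snd (L : Set (Phase ℝ n))) (μ : Measure L) [μ.IsAddHaarMeasure] :
    Integrable (fun X : L => diracWeight A (X : Phase ℝ n)) μ := by
  rw [integrable_haar_iff μ (Module.finBasis ℝ L)]
  simp only [diracWeight_equivFun_symm]
  exact integrable_gaussExp (posDef_re_diracMatrix hA hIm hiso hproj _) _

theorem integral_diracWeight (μ : Measure L) [μ.IsAddHaarMeasure]
    (e : Module.Basis (Fin k) ℝ L) :
    ∫ X : L, diracWeight A (X : Phase ℝ n) ∂μ =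
      (μ (parallelepiped e)).toReal * gaussConst (diracMatrix A e) := by
  simp only [integral_haar_eq μ e, diracWeight_equivFun_symm, real_smul, gaussConst]

theorem diracMatrix_mulVec_repr (e : Module.Basis (Fin k) ℝ L) {Y : Phase ℂ n}
    {Z : complexify L} (hgraph : Y - Z ∈ graph A) (hskew : Y - Z ∈ skewOrth (complexify L)) :
    diracMatrix A e *ᵥ ⇑((complexBasis e).repr Z) = I • diracVector A e Y.2 := by
  rw [diracMatrix_mulVec, sum_repr_complexBasis, ← diracVector_eq_of_graphMap_sub_mem]
  rwa [← Prod.snd_sub, graphMap_snd_of_mem hgraph]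

theorem diracVector_dotProduct_repr (hA : A.IsSymm) (e : Module.Basis (Fin k) ℝ L)
    {Y : Phase ℂ n} {Z : complexify L} (hgraph : Y - Z ∈ graph A) :
    diracVector A e Y.2 ⬝ᵥ ⇑((complexBasis e).repr Z) = Y.2 ⬝ᵥ Y.1 - Y.2 ⬝ᵥ A *ᵥ Y.2 := by
  have hYZ : Y.1 - (Z : Phase ℂ n).1 = A *ᵥ (Y.2 - (Z : Phase ℂ n).2) := mem_graph_iff.1 hgraph
  have hsub : (Z : Phase ℂ n).1 - A *ᵥ (Z : Phase ℂ n).2 = Y.1 - A *ᵥ Y.2 := by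
    rw [mulVec_sub] at hYZ
    linear_combination (exp := 1) -hYZ
  rw [diracVector_dotProduct, sum_repr_complexBasis, omega_swap, omega_graphMap_left hA, neg_neg,
    hsub, sub_dotProduct, dotProduct_comm Y.1, dotProduct_comm (A *ᵥ _)]

theorem integral_expOmega_gaussian (hA : A.IsSymm) (hIm : (A.map im).PosDef)
    (hiso : ∀ X ∈ L, ∀ Y ∈ L, omega X Y = 0)
    (hproj : Set.InjOn Prod.snd (L : Set (Phase ℝ n))) (μ : Measure L) [μ.IsAddHaarMeasure]
    {ξ : Fin n → ℝ} {Y : Phase ℂ n} {Z : complexify L} (hY : Y.2 = cvec ξ)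
    (hgraph : Y - Z ∈ graph A) (hskew : Y - Z ∈ skewOrth (complexify L)) :
    ∫ X : L, expOmega (X : Phase ℝ n) (gaussian c A) ξ ∂μ =
      c * (∫ X : L, diracWeight A (X : Phase ℝ n) ∂μ) *
        Complex.exp (I / 2 * (cvec ξ ⬝ᵥ Y.1)) := by
  let e := Module.finBasis ℝ L
  have hsolve : diracMatrix A e *ᵥ (-I • ⇑((complexBasis e).repr Z)) =
      diracVector A e (cvec ξ) := by
    rw [mulVec_smul, diracMatrix_mulVec_repr e hgraph hskew, smul_smul, neg_mul, I_mul_I, neg_neg,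
      one_smul, hY]
  have hdot : diracVector A e (cvec ξ) ⬝ᵥ (-I • ⇑((complexBasis e).repr Z)) =
      -I * (cvec ξ ⬝ᵥ Y.1 - cvec ξ ⬝ᵥ A *ᵥ cvec ξ) := by
    rw [dotProduct_smul, smul_eq_mul, ← hY, diracVector_dotProduct_repr hA e hgraph]
  have hexp : Complex.exp (I / 2 * (cvec ξ ⬝ᵥ A *ᵥ cvec ξ)) *
      Complex.exp (-(1 / 2) * (-I * (cvec ξ ⬝ᵥ Y.1 - cvec ξ ⬝ᵥ A *ᵥ cvec ξ))) =
      Complex.exp (I / 2 * (cvec ξ ⬝ᵥ Y.1)) := by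
    rw [← Complex.exp_add]
    congr 1
    ring
  rw [integral_diracWeight μ e, integral_haar_eq μ e]
  simp only [expOmega_gaussian_equivFun_symm hA]
  rw [integral_const_mul, integral_gaussExp (isSymm_diracMatrix hA hiso e)
    (posDef_re_diracMatrix hA hIm hiso hproj e) hsolve, hdot, gaussian_apply, real_smul, ← hexp]
  ring

theorem integral_expOmega_gaussian_eq_gaussian (hA : A.IsSymm) (hIm : (A.map im).PosDef)
    (hiso : ∀ X ∈ L, ∀ Y ∈ L, omega X Y = 0)
    (hproj : Set.InjOn Prod.snd (L : Set (Phase ℝ n))) (μ : Measure L) [μ.IsAddHaarMeasure]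
    (hψ : sGerm (gaussian c A) = graph A) {R : Submodule ℂ (Phase ℂ n)}
    (hC' : Function.Bijective (projQ R)) {Pr : R →ₗ[ℂ] complexify L}
    (hPr : IsPi L (gaussian c A) Pr) (ξ : Fin n → ℝ) :
    ∫ X : L, expOmega (X : Phase ℝ n) (gaussian c A) ξ ∂μ =
      gaussian (c * ∫ X : L, diracWeight A (X : Phase ℝ n) ∂μ)
        (LinearMap.toMatrix' (projP R ∘ₗ projQInv hC')) ξ := by
  have hYZ := hPr (projQInv hC' (cvec ξ))
  rw [integral_expOmega_gaussian hA hIm hiso hproj μ (projQInv_snd hC' _) (hψ.le hYZ.1) hYZ.2,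
    gaussian_apply, LinearMap.toMatrix'_mulVec]
  rfl

end DiracFunction

section Distribution

variable {n : ℕ} {A : Matrix (Fin n) (Fin n) ℂ} {L : Submodule ℝ (Phase ℝ n)}

theorem exists_norm_gaussian_le (c : ℂ) (hIm : (A.map im).PosDef) (N : ℕ) :
    ∃ K, ∀ ξ, (1 + ‖ξ‖) ^ N * ‖gaussian c A ξ‖ ≤ K := by
  obtain ⟨K, hbound⟩ :=
    exists_norm_gaussExp_le (S := -I • A) (by rwa [map_re_neg_I_smul]) 0 N
  refine ⟨‖c‖ * K, fun ξ => ?_⟩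
  rw [gaussian_eq_gaussExp, norm_mul, mul_left_comm]
  gcongr
  exact hbound ξ

theorem norm_expOmega (X : Phase ℝ n) (ψ : (Fin n → ℝ) → ℂ) (ξ : Fin n → ℝ) :
    ‖expOmega X ψ ξ‖ = ‖ψ (ξ - X.2)‖ := by
  rw [expOmega, norm_mul, norm_exp_I_mul_ofReal, one_mul]

theorem exists_one_add_norm_le (hproj : Set.InjOn Prod.snd (L : Set (Phase ℝ n))) :
    ∃ M ≥ 0, ∀ X : L, 1 + ‖X‖ ≤ M * (1 + ‖(X : Phase ℝ n).2‖) := by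
  let g : L →ₗ[ℝ] (Fin n → ℝ) := (LinearMap.snd ℝ _ _).domRestrict L
  have hg : LinearMap.ker g = ⊥ := LinearMap.ker_eq_bot.2 fun X Y h =>
    Subtype.ext (hproj X.2 Y.2 h)
  obtain ⟨K, -, hK⟩ := g.exists_antilipschitzWith hg
  refine ⟨1 + K, by positivity, fun X => ?_⟩
  have hX : ‖X‖ ≤ K * ‖(X : Phase ℝ n).2‖ := by
    have hdist := hK.le_mul_dist X 0
    rwa [dist_zero_right, map_zero, dist_zero_right] at hdist
  nlinarith [norm_nonneg (X : Phase ℝ n).2, K.coe_nonneg]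

theorem continuous_expOmega_gaussian (c : ℂ) :
    Continuous fun p : L × (Fin n → ℝ) => expOmega (p.1 : Phase ℝ n) (gaussian c A) p.2 := by
  unfold expOmega gaussian dotProduct
  simp only [Pi.sub_apply]
  fun_prop

theorem exists_norm_expOmega_gaussian_le (c : ℂ) (hIm : (A.map im).PosDef)
    (hproj : Set.InjOn Prod.snd (L : Set (Phase ℝ n))) (N : ℕ) :
    ∃ K, ∀ (X : L) ξ, (1 + ‖X‖) ^ N * ‖expOmega (X : Phase ℝ n) (gaussian c A) ξ‖ ≤
      K * (1 + ‖ξ‖) ^ N := by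
  obtain ⟨K, hbound⟩ := exists_norm_gaussian_le c hIm N
  obtain ⟨M, hM, hle⟩ := exists_one_add_norm_le hproj
  refine ⟨M ^ N * K, fun X ξ => ?_⟩
  rw [norm_expOmega]
  set Q := (X : Phase ℝ n).2
  have htriangle : 1 + ‖Q‖ ≤ (1 + ‖ξ - Q‖) * (1 + ‖ξ‖) := by
    have hQ := norm_sub_le ξ (ξ - Q)
    rw [sub_sub_cancel] at hQ
    nlinarith [norm_nonneg ξ, norm_nonneg (ξ - Q)]
  calc (1 + ‖X‖) ^ N * ‖gaussian c A (ξ - Q)‖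
      ≤ (M * ((1 + ‖ξ - Q‖) * (1 + ‖ξ‖))) ^ N * ‖gaussian c A (ξ - Q)‖ := by
        gcongr
        exact (hle X).trans (by gcongr)
    _ = M ^ N * ((1 + ‖ξ - Q‖) ^ N * ‖gaussian c A (ξ - Q)‖) * (1 + ‖ξ‖) ^ N := by
        rw [mul_pow, mul_pow]
        ring
    _ ≤ M ^ N * K * (1 + ‖ξ‖) ^ N := by
        gcongr
        exact hbound _

theorem integrable_one_add_norm_pow_mul_schwartz (φ : 𝓢(Fin n → ℝ, ℂ)) (N : ℕ) :
    Integrable fun ξ => (1 + ‖ξ‖) ^ N * ‖φ ξ‖ := by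
  have hsum := ((φ.integrable_pow_mul volume 0).add (φ.integrable_pow_mul volume N)).const_mul
    (2 ^ (N - 1))
  refine hsum.mono' (by fun_prop) (Filter.Eventually.of_forall fun ξ => ?_)
  have hpow := add_pow_le zero_le_one (norm_nonneg ξ) N
  rw [Real.norm_of_nonneg (by positivity)]
  calc (1 + ‖ξ‖) ^ N * ‖φ ξ‖ ≤ 2 ^ (N - 1) * (1 ^ N + ‖ξ‖ ^ N) * ‖φ ξ‖ := by gcongr
    _ = 2 ^ (N - 1) * (‖ξ‖ ^ 0 * ‖φ ξ‖ + ‖ξ‖ ^ N * ‖φ ξ‖) := by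
        rw [one_pow, pow_zero]
        ring

theorem integrable_schwartz_mul_expOmega (c : ℂ) (hIm : (A.map im).PosDef)
    (hproj : Set.InjOn Prod.snd (L : Set (Phase ℝ n))) (μ : Measure L) [μ.IsAddHaarMeasure]
    (φ : 𝓢(Fin n → ℝ, ℂ)) :
    Integrable (fun p : L × (Fin n → ℝ) =>
      star (φ p.2) * expOmega (p.1 : Phase ℝ n) (gaussian c A) p.2) (μ.prod volume) := by
  set N := Module.finrank ℝ L + 1 with hN
  obtain ⟨K, hbound⟩ := exists_norm_expOmega_gaussian_le c hIm hproj N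
  have hdecay : Integrable (fun X : L => (1 + ‖X‖) ^ (-(N : ℝ))) μ :=
    integrable_one_add_norm (by rw [hN]; exact_mod_cast Nat.lt_succ_self _)
  refine ((hdecay.const_mul K).mul_prod (integrable_one_add_norm_pow_mul_schwartz φ N)).mono'
    ((φ.continuous.comp continuous_snd).star.mul
      (continuous_expOmega_gaussian c)).aestronglyMeasurable
    (Filter.Eventually.of_forall fun ⟨X, ξ⟩ => ?_)
  have hpos : 0 < (1 + ‖X‖) ^ N := by positivity
  have hdiv : ‖expOmega (X : Phase ℝ n) (gaussian c A) ξ‖ ≤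
      K * ((1 + ‖X‖) ^ N)⁻¹ * (1 + ‖ξ‖) ^ N := by
    rw [mul_right_comm, ← div_eq_mul_inv, le_div_iff₀' hpos]
    exact hbound X ξ
  rw [Real.rpow_neg (by positivity), Real.rpow_natCast, norm_mul, norm_star]
  calc ‖φ ξ‖ * ‖expOmega (X : Phase ℝ n) (gaussian c A) ξ‖
      ≤ ‖φ ξ‖ * (K * ((1 + ‖X‖) ^ N)⁻¹ * (1 + ‖ξ‖) ^ N) := by gcongr
    _ = K * ((1 + ‖X‖) ^ N)⁻¹ * ((1 + ‖ξ‖) ^ N * ‖φ ξ‖) := by ring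

theorem pairing_integral_expOmega (c : ℂ) (hIm : (A.map im).PosDef)
    (hproj : Set.InjOn Prod.snd (L : Set (Phase ℝ n))) (μ : Measure L) [μ.IsAddHaarMeasure]
    (φ : 𝓢(Fin n → ℝ, ℂ)) {ψD : (Fin n → ℝ) → ℂ}
    (hψD : ∀ ξ, ∫ X : L, expOmega (X : Phase ℝ n) (gaussian c A) ξ ∂μ = ψD ξ) :
    Integrable (fun X : L => pairing φ (expOmega (X : Phase ℝ n) (gaussian c A))) μ ∧
      Integrable (fun ξ => star (φ ξ) * ψD ξ) ∧
      ∫ X : L, pairing φ (expOmega (X : Phase ℝ n) (gaussian c A)) ∂μ = pairing φ ψD := by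
  have hprod := integrable_schwartz_mul_expOmega (A := A) c hIm hproj μ φ
  have hinner : ∀ ξ, ∫ X : L, star (φ ξ) * expOmega (X : Phase ℝ n) (gaussian c A) ξ ∂μ =
      star (φ ξ) * ψD ξ := fun ξ => by rw [integral_const_mul, hψD]
  refine ⟨hprod.integral_prod_left, ?_, ?_⟩
  · simpa only [hinner] using hprod.integral_prod_right
  · simp only [pairing]
    rw [integral_integral_swap hprod]
    simp only [hinner]

end Distribution

section Jacobian

variable {n k : ℕ} {A : Matrix (Fin n) (Fin n) ℂ} {L : Submodule ℝ (Phase ℝ n)}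

theorem gramMatrix_map_ofReal_eq_mul (hA : A.IsSymm) (hIm : (A.map im).PosDef)
    (hiso : ∀ X ∈ L, ∀ Y ∈ L, omega X Y = 0) (e : Module.Basis (Fin k) ℝ L) {f : Fin k → Phase ℂ n}
    {P : Matrix (Fin k) (Fin k) ℂ} (hP : ∀ b, germProj A (toC (e b)) = ∑ a, P a b • f a) :
    (gramMatrix A e).map ofReal =
      Pᵀ * Matrix.of (fun a b => hermForm (f a) (f b)) * P.map star := by
  rw [gramMatrix_map_ofReal hA hIm hiso, Matrix.mul_assoc]
  ext a b
  rw [of_apply, hP, hP, hermForm_sum_smul]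
  rfl

theorem det_gramMatrix_eq (hA : A.IsSymm) (hIm : (A.map im).PosDef)
    (hiso : ∀ X ∈ L, ∀ Y ∈ L, omega X Y = 0) (e : Module.Basis (Fin k) ℝ L) {f : Fin k → Phase ℂ n}
    {P : Matrix (Fin k) (Fin k) ℂ} (hP : ∀ b, germProj A (toC (e b)) = ∑ a, P a b • f a) :
    (gramMatrix A e).det = ‖P.det‖ ^ 2 * ‖(Matrix.of fun a b => hermForm (f a) (f b)).det‖ := by
  have hstar : (P.map star).det = star P.det := (RingHom.map_det (starRingEnd ℂ) P).symm
  have hdet := congrArg (‖det ·‖) (gramMatrix_map_ofReal_eq_mul hA hIm hiso e hP)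
  rw [det_map_ofReal, norm_real, Real.norm_of_nonneg (posDef_gramMatrix hA hIm hiso e).det_pos.le,
    det_mul, det_mul, det_transpose, hstar, norm_mul, norm_mul, norm_star] at hdet
  rw [hdet]
  ring

theorem jacobianMinus_eq (hA : A.IsSymm) (hIm : (A.map im).PosDef)
    (hiso : ∀ X ∈ L, ∀ Y ∈ L, omega X Y = 0) {ψ : (Fin n → ℝ) → ℂ} (hψ : sGerm ψ = graph A)
    (μ : Measure L) {Pm : complexify L →ₗ[ℂ] rMinus L ψ} (hPm : IsPMinus Pm)
    (e : Module.Basis (Fin k) ℝ L) (f : Module.Basis (Fin k) ℂ (rMinus L ψ)) :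
    jacobianMinus μ Pm e f =
      Real.sqrt (gramMatrix A e).det / (μ (parallelepiped e)).toReal := by
  have hexpand : ∀ b, germProj A (toC (e b)) =
      ∑ a, Matrix.of (fun a b => f.repr (Pm (inC L (e b))) a) a b • (f a : Phase ℂ n) := fun b => by
    have hsum := congrArg Subtype.val (f.sum_repr (Pm (inC L (e b))))
    rw [hPm.coe_apply hIm hψ, Submodule.coe_sum] at hsum
    exact hsum.symm
  rw [det_gramMatrix_eq hA hIm hiso e hexpand, Real.sqrt_mul (by positivity),
    Real.sqrt_sq (norm_nonneg _)]
  rfl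

end Jacobian

section Determinant

variable {n k : ℕ} {A : Matrix (Fin n) (Fin n) ℂ} {L : Submodule ℝ (Phase ℝ n)}
  {T : complexify L →ₗ[ℂ] complexify L}

theorem graphMap_germCoord_sub_mem {ψ : (Fin n → ℝ) → ℂ} (hIm : (A.map im).PosDef)
    (hψ : sGerm ψ = graph A) {R : Submodule ℂ (Phase ℂ n)} (hLR : complexify L ≤ R)
    (hC' : Function.Bijective (projQ R)) {Pm : complexify L →ₗ[ℂ] rMinus L ψ}
    {Pr : R →ₗ[ℂ] complexify L} {PP : R →ₗ[ℂ] sGerm ψ} (hPm : IsPMinus Pm) (hPr : IsPi L ψ Pr)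
    (hPP : IsCalPMinus Pm PP) (Z : complexify L) :
    graphMap A (germCoord A Z - ((Pr ∘ₗ projQInv hC' ∘ₗ projQ (sGerm ψ) ∘ₗ PP ∘ₗ
      Submodule.inclusion hLR) Z : Phase ℂ n).2) ∈ skewOrth (complexify L) := by
  have hcoord : projQ (sGerm ψ) (PP (Submodule.inclusion hLR Z)) = germCoord A Z := by
    have hPZ := hPP.2 (Submodule.inclusion hLR Z) Z.2
    rw [hPm.coe_apply hIm hψ] at hPZ
    exact congrArg Prod.snd hPZ
  have hYZ := hPr.graphMap_sub hψ (projQInv hC' (germCoord A Z))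
  rw [projQInv_snd] at hYZ
  simp only [LinearMap.comp_apply, hcoord, hYZ]
  exact (hPr _).2

theorem diracMatrix_mul_toMatrix (hA : A.IsSymm) (hIm : (A.map im).PosDef)
    (hiso : ∀ X ∈ L, ∀ Y ∈ L, omega X Y = 0)
    (hT : ∀ Z : complexify L,
      graphMap A (germCoord A Z - (T Z : Phase ℂ n).2) ∈ skewOrth (complexify L))
    (e : Module.Basis (Fin k) ℝ L) :
    diracMatrix A e * LinearMap.toMatrix (complexBasis e) (complexBasis e) T =
      (gramMatrix A e).map ofReal := by
  rw [← (isSymm_map_ofReal (posDef_gramMatrix hA hIm hiso e)).eq, gramMatrix_map_ofReal hA hIm hiso]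
  ext a b
  have hcol : (fun i => LinearMap.toMatrix (complexBasis e) (complexBasis e) T i b) =
      ⇑((complexBasis e).repr (T (inC L (e b)))) := by
    ext i
    rw [LinearMap.toMatrix_apply, complexBasis_apply]
  calc (diracMatrix A e * LinearMap.toMatrix (complexBasis e) (complexBasis e) T) a b
      = (diracMatrix A e *ᵥ ⇑((complexBasis e).repr (T (inC L (e b))))) a := by
        rw [← hcol]
        rfl
    _ = I * omega (toC (e a)) (germProj A (toC (e b))) := by
        rw [diracMatrix_mulVec, sum_repr_complexBasis,
          ← diracVector_eq_of_graphMap_sub_mem (hT (inC L (e b)))]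
        rfl
    _ = hermForm (germProj A (toC (e b))) (toC (e a)) := by
        rw [omega_swap, hermForm, star_toC, one_div, inv_I]
        ring
    _ = hermForm (germProj A (toC (e b))) (germProj A (toC (e a))) :=
        (hermForm_germProj_right hA hIm (germProj_mem_graph _) _).symm

theorem sqrtDet_sq {V : Type} [AddCommGroup V] [Module ℂ V] [Module.Finite ℂ V]
    (T : V →ₗ[ℂ] V) : sqrtDet T ^ 2 = LinearMap.det T := by
  rw [sqrtDet, ← Multiset.prod_map_pow,
    Module.End.det_eq_prod_roots_charpoly_of_splits (IsAlgClosed.splits _)]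
  simp only [cpow_half_sq, Multiset.map_id']

theorem gaussConst_diracMatrix (hA : A.IsSymm) (hIm : (A.map im).PosDef)
    (hiso : ∀ X ∈ L, ∀ Y ∈ L, omega X Y = 0)
    (hproj : Set.InjOn Prod.snd (L : Set (Phase ℝ n)))
    (hT : ∀ Z : complexify L,
      graphMap A (germCoord A Z - (T Z : Phase ℂ n).2) ∈ skewOrth (complexify L))
    (e : Module.Basis (Fin k) ℝ L) :
    gaussConst (diracMatrix A e) =
      (((2 * Real.pi) ^ ((k : ℝ) / 2) / Real.sqrt (gramMatrix A e).det : ℝ) : ℂ) * sqrtDet T := by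
  have h := gaussConst_eq (isSymm_diracMatrix hA hiso e)
    (posDef_re_diracMatrix hA hIm hiso hproj e) (posDef_gramMatrix hA hIm hiso e)
    (diracMatrix_mul_toMatrix hA hIm hiso hT e)
  rwa [LinearMap.charpoly_toMatrix, Fintype.card_fin] at h

theorem re_pos_of_hasEigenvalue (hA : A.IsSymm) (hIm : (A.map im).PosDef)
    (hiso : ∀ X ∈ L, ∀ Y ∈ L, omega X Y = 0)
    (hproj : Set.InjOn Prod.snd (L : Set (Phase ℝ n)))
    (hT : ∀ Z : complexify L,
      graphMap A (germCoord A Z - (T Z : Phase ℂ n).2) ∈ skewOrth (complexify L))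
    {z : ℂ} (hz : Module.End.HasEigenvalue T z) : 0 < z.re := by
  let e := Module.finBasis ℝ L
  refine re_pos_of_mem_roots_charpoly (isSymm_diracMatrix hA hiso e)
    (posDef_re_diracMatrix hA hIm hiso hproj e) (posDef_gramMatrix hA hIm hiso e)
    (diracMatrix_mul_toMatrix hA hIm hiso hT e) ?_
  rw [LinearMap.charpoly_toMatrix]
  exact Polynomial.mem_roots'.2 ⟨T.charpoly_monic.ne_zero,
    (Module.End.hasEigenvalue_iff_isRoot_charpoly T z).1 hz⟩

theorem integral_diracWeight_eq (hA : A.IsSymm) (hIm : (A.map im).PosDef)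
    (hiso : ∀ X ∈ L, ∀ Y ∈ L, omega X Y = 0)
    (hproj : Set.InjOn Prod.snd (L : Set (Phase ℝ n))) (μ : Measure L) [μ.IsAddHaarMeasure]
    {ψ : (Fin n → ℝ) → ℂ} (hψ : sGerm ψ = graph A)
    (hT : ∀ Z : complexify L,
      graphMap A (germCoord A Z - (T Z : Phase ℂ n).2) ∈ skewOrth (complexify L))
    {Pm : complexify L →ₗ[ℂ] rMinus L ψ} (hPm : IsPMinus Pm)
    (e : Module.Basis (Fin k) ℝ L) (f : Module.Basis (Fin k) ℂ (rMinus L ψ)) :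
    ∫ X : L, diracWeight A (X : Phase ℝ n) ∂μ =
      (((2 * Real.pi) ^ ((k : ℝ) / 2) : ℝ) : ℂ) * sqrtDet T / (jacobianMinus μ Pm e f : ℂ) := by
  have hvolume : ((μ (parallelepiped e)).toReal : ℂ) ≠ 0 := ofReal_ne_zero.2 <|
    ENNReal.toReal_ne_zero.2 ⟨measure_parallelepiped_ne_zero μ e, measure_parallelepiped_ne_top μ e⟩
  have hdet : ((Real.sqrt (gramMatrix A e).det : ℝ) : ℂ) ≠ 0 :=
    ofReal_ne_zero.2 (Real.sqrt_pos.2 (posDef_gramMatrix hA hIm hiso e).det_pos).ne'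
  rw [integral_diracWeight μ e, gaussConst_diracMatrix hA hIm hiso hproj hT e,
    jacobianMinus_eq hA hIm hiso hψ μ hPm e f, ofReal_div, ofReal_div]
  field_simp

theorem diracWeight_eq_exp_projQInv {ψ : (Fin n → ℝ) → ℂ} (hψ : sGerm ψ = graph A)
    (hC : Function.Bijective (projQ (sGerm ψ))) {R : Submodule ℂ (Phase ℂ n)} {X : Phase ℝ n}
    (hX : toC X ∈ R) :
    diracWeight A X =
      Complex.exp (-(I / 2) * omega (toC X) (projQInv hC (projQ R ⟨toC X, hX⟩) : Phase ℂ n)) := by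
  have hproj : projQInv hC (projQ R ⟨toC X, hX⟩) =
      ⟨graphMap A (toC X).2, hψ.ge (graphMap_mem_graph _)⟩ := projQInv_eq hC rfl
  rw [hproj]
  rfl

end Determinant

end LinearConstraint

end

theorem lemma14 {n k : ℕ} (L : Submodule ℝ (Phase ℝ n)) (hk : Module.finrank ℝ L = k)
    (hiso : ∀ X ∈ L, ∀ Y ∈ L, omega X Y = 0)
    (hproj : Set.InjOn Prod.snd (L : Set (Phase ℝ n)))
    (μ : Measure L) [μ.IsAddHaarMeasure]
    (A : Matrix (Fin n) (Fin n) ℂ) (hA : A.IsSymm) (hIm : (A.map Complex.im).PosDef)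
    (c : ℂ) (hc : c ≠ 0) :
    ∃ (R : Submodule ℂ (Phase ℂ n)) (hLR : complexify L ≤ R)
      (hC : Function.Bijective (projQ (sGerm (gaussian c A))))
      (hC' : Function.Bijective (projQ R))
      (Pm : complexify L →ₗ[ℂ] rMinus L (gaussian c A))
      (Pr : R →ₗ[ℂ] complexify L)
      (PP : R →ₗ[ℂ] sGerm (gaussian c A))
      (A' : Matrix (Fin n) (Fin n) ℂ) (c' : ℂ) (T : complexify L →ₗ[ℂ] complexify L),
      -- the H-germ is the subspace `R`; the operators `P₋`, `Π`, `𝒫₋` exist and are unique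
      (R : Set (Phase ℂ n)) = hGerm L μ (gaussian c A) ∧
      (IsPMinus Pm ∧ (∀ Pm' : complexify L →ₗ[ℂ] rMinus L (gaussian c A),
        IsPMinus Pm' → Pm' = Pm) ∧ Function.Bijective Pm) ∧
      (IsPi L (gaussian c A) Pr ∧ ∀ Pr' : R →ₗ[ℂ] complexify L,
        IsPi L (gaussian c A) Pr' → Pr' = Pr) ∧
      (IsCalPMinus Pm PP ∧ ∀ PP' : R →ₗ[ℂ] sGerm (gaussian c A),
        IsCalPMinus Pm PP' → PP' = PP) ∧
      -- the Dirac wave function, pointwise and as a distribution, is the Gaussian of `c'`, `A'`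
      (∀ ξ, Integrable (fun X : L => expOmega (X : Phase ℝ n) (gaussian c A) ξ) μ ∧
        ∫ X : L, expOmega (X : Phase ℝ n) (gaussian c A) ξ ∂μ = gaussian c' A' ξ) ∧
      (∀ φ : 𝓢(Fin n → ℝ, ℂ),
        Integrable (fun X : L => pairing φ (expOmega (X : Phase ℝ n) (gaussian c A))) μ ∧
        Integrable (fun ξ => star (φ ξ) * gaussian c' A' ξ) ∧
        ∫ X : L, pairing φ (expOmega (X : Phase ℝ n) (gaussian c A)) ∂μ =
          pairing φ (gaussian c' A')) ∧
      -- the matrix `A'`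
      A' = LinearMap.toMatrix' (projP R ∘ₗ projQInv hC') ∧
      -- the constant `c'`, as an integral
      Integrable (fun X : L => Complex.exp (-(Complex.I / 2) * omega (toC (X : Phase ℝ n))
        (projQInv hC (projQ R ⟨toC (X : Phase ℝ n), hLR (inC L X).2⟩) : Phase ℂ n))) μ ∧
      c' = c * ∫ X : L, Complex.exp (-(Complex.I / 2) * omega (toC (X : Phase ℝ n))
        (projQInv hC (projQ R ⟨toC (X : Phase ℝ n), hLR (inC L X).2⟩) : Phase ℂ n)) ∂μ ∧
      -- the constant `c'`, through the determinant of `T = Π Č⁻¹ C 𝒫₋` on `L^ℂ`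
      T = Pr ∘ₗ projQInv hC' ∘ₗ projQ (sGerm (gaussian c A)) ∘ₗ PP ∘ₗ
        Submodule.inclusion hLR ∧
      (∀ z : ℂ, Module.End.HasEigenvalue T z → 0 < z.re) ∧
      sqrtDet T ^ 2 = LinearMap.det T ∧
      (∀ (e : Module.Basis (Fin k) ℝ L)
        (f : Module.Basis (Fin k) ℂ (rMinus L (gaussian c A))),
        c' = c * (((2 * Real.pi) ^ ((k : ℝ) / 2) : ℝ) : ℂ) * sqrtDet T /
          (jacobianMinus μ Pm e f : ℂ)) := by
  have hψ := sGerm_gaussian hA hc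
  have hdisj := disjoint_complexify_rPerp hA hIm hiso hψ
  have hLR : complexify L ≤ complexify L ⊔ rPerp L (gaussian c A) := le_sup_left
  have hC := bijective_projQ_sGerm hψ
  have hC' := bijective_projQ_sup hA hIm hiso hproj hψ
  obtain ⟨Pm, hPm⟩ := exists_isPMinus hA hIm hiso hψ
  obtain ⟨Pr, hPr⟩ := exists_isPi hdisj
  obtain ⟨PP, hPP⟩ := exists_isCalPMinus hPr hdisj Pm
  have hT := graphMap_germCoord_sub_mem hIm hψ hLR hC' hPm hPr hPP
  have hdirac := integral_expOmega_gaussian_eq_gaussian hA hIm hiso hproj μ hψ hC' hPr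
  refine ⟨_, hLR, hC, hC', Pm, Pr, PP, _, c * ∫ X : L, diracWeight A X ∂μ, _,
    (hGerm_gaussian hA hIm hc hiso μ).symm,
    ⟨hPm, fun _ hPm' => hPm.eq hPm' hIm hψ, hPm.bijective hA hIm hiso hψ⟩,
    ⟨hPr, fun _ => hPr.eq hdisj⟩, ⟨hPP, fun _ => hPP.eq hPr hLR⟩,
    fun ξ => ⟨integrable_expOmega_gaussian hA hIm hiso hproj μ ξ, hdirac ξ⟩,
    fun φ => pairing_integral_expOmega c hIm hproj μ φ hdirac, rfl, ?_, ?_, rfl,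
    fun _ => re_pos_of_hasEigenvalue hA hIm hiso hproj hT, sqrtDet_sq _, fun e f => ?_⟩
  · simpa only [diracWeight_eq_exp_projQInv hψ hC (hLR (inC L _).2)] using
      integrable_diracWeight hA hIm hiso hproj μ
  · simp only [diracWeight_eq_exp_projQInv hψ hC (hLR (inC L _).2)]
  · rw [integral_diracWeight_eq hA hIm hiso hproj μ hψ hT hPm e f, ← mul_div_assoc, ← mul_assoc]
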